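/- Let $d,M\ge 1$ and $L\ge 0$ be integers. For $h\in\mathbb R^d$ and $C\in\mathbb R^{d\times L}$ (the columns of $C$ are the control variates) let $x=[\mathrm{vec}(C),h]\in\mathbb R^p$, $p=dL+d$, where $\mathrm{vec}$ stacks the columns. Given $\theta=(\eta,\Lambda)$, with $\eta\in\mathbb R^p$ and $\Lambda$ a symmetric positive definite $p\times p$ matrix, let $x\sim\mathcal N(\Lambda^{-1}\eta,\Lambda^{-1})$, i.e. $x$ has density $\exp\big(\eta^Tx-\tfrac12 x^T\Lambda x-A(\eta,\Lambda)\big)$ with $$A(\eta,\Lambda)=\tfrac12\eta^T\Lambda^{-1}\eta-\tfrac12\log\det\Lambda+\tfrac p2\log 2\pi .$$ Let the prior on $\theta$ be the conjugate Normal-Wishart distribution whose density with respect to Lebesgue measure on $\{(\eta,\Lambda):\Lambda\succ0\}$ satisfies $$p(\eta,\Lambda)\ \propto\ \exp\big(t_0^T\eta-\tfrac12\mathrm{tr}(V_0^T\Lambda)-n_0A(\eta,\Lambda)\big),\qquad V_0=v_0I,$$ with real $n_0>0$, $v_0$ and $t_0\in\mathbb R^p$ satisfying $\|t_0\|^2<n_0v_0$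 (these conditions hold exactly when the right-hand side is integrable). Given $\theta$, let $(C_1,h_1),\dots,(C_M,h_M)$ be i.i.d. from this Gaussian. For a measurable decision rule $\delta$, mapping $(C_1,h_1,\dots,C_M,h_M)$ to a vector in $\mathbb R^L$, let $$\mathrm{BayesRegret}(\delta)=\mathbb E_\theta\,\mathbb E_{C_1,h_1,\dots,C_M,h_M|\theta}\big[L(\delta(C_1,h_1,\dots,C_M,h_M),\theta)\big],\qquad L(a,\theta)=\mathbb E_{C,h|\theta}\|h+Ca\|^2 .$$ Theorem. The prior is a probability measure, and the Bayesian regret over all measurable decision rules is minimised by $$\delta^*(C_1,h_1,\dots,C_M,h_M)=-\Big(\frac{d\,v_0}{M}I+\overline{C^TC}\Big)^{-1}\overline{C^Th},\qquad \overline{C^TC}=\frac1M\sum_{m=1}^MC_m^TC_m,\quad \overline{C^Th}=\frac1M\sum_{m=1}^MC_m^Th_m ,$$ where the matrix to be inverted is always invertible. The rule $\delta^*$ is measurable, its regret is finite, and it is the only minimiser up to Lebesgue-null sets of data: a measurable rule $\delta$ has the same regret as $\delta^*$ if and only if $\delta=\delta^*$ for Lebesgue-almost every $(C_1,h_1,\dots,C_M,h_M)$.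 -/

import Mathlib

open MeasureTheory
open scoped Matrix ENNReal

noncomputable section

namespace CVBayes

/-- Coordinates of the stacked vector `[vec(C), h]`, where `C` is a `d × L` matrix (its columns are
the control variates, and `vec` stacks these columns) and `h ∈ ℝ^d` is the base gradient. -/
abbrev Idx (d L : ℕ) : Type := (Fin L × Fin d) ⊕ Fin d

/-- An observation `x = [vec(C), h]`. -/
abbrev Obs (d L : ℕ) : Type := EuclideanSpace ℝ (Idx d L)

/-- The matrix `C` of control variates contained in an observation `[vec(C), h]`. -/
def ctrl {d L : ℕ} (x : Obs d L) : Matrix (Fin d) (Fin L) ℝ :=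
  Matrix.of fun i l => x (Sum.inl (l, i))

/-- The base gradient `h` contained in an observation `[vec(C), h]`. -/
def grad {d L : ℕ} (x : Obs d L) : Fin d → ℝ :=
  fun i => x (Sum.inr i)

/-- `x` is `[vec(C), h]` for `C = ctrl x` and `h = grad x`. -/
theorem obs_eq_vec_append {d L : ℕ} (x : Obs d L) :
    x = WithLp.toLp 2 (Sum.elim (ctrl x).vec (grad x)) := by
  ext i
  rcases i with ⟨l, i⟩ | i <;> rfl

/-- The symmetric matrix with entries `u s(i, j)`. A function on unordered pairs of indices is the
family of the free entries of a symmetric matrix, so `volume` on `Sym2 ι → ℝ` is Lebesgue measure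
on the space of symmetric matrices. -/
def symMatrix {ι : Type*} (u : Sym2 ι → ℝ) : Matrix ι ι ℝ :=
  Matrix.of fun i j => u s(i, j)

/-- A canonical parameter `θ = (η, Λ)`, with the symmetric matrix `Λ` given by its free entries. -/
abbrev Param (ι : Type*) : Type _ := (ι → ℝ) × (Sym2 ι → ℝ)

/-- The precision matrix `Λ` of `θ = (η, Λ)`. -/
def precision {ι : Type*} (θ : Param ι) : Matrix ι ι ℝ := symMatrix θ.2

section

variable {ι : Type*} [Fintype ι] [DecidableEq ι]

/-- The likelihood `Gaussian(· | μ = Λ⁻¹ η, Σ = Λ⁻¹)`. -/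
def likelihood (θ : Param ι) : Measure (EuclideanSpace ℝ ι) :=
  ProbabilityTheory.multivariateGaussian
    (WithLp.toLp 2 ((precision θ)⁻¹ *ᵥ θ.1)) (precision θ)⁻¹

/-- The log-partition function of the Gaussian family in canonical form,
`A(η, Λ) = log ∫ exp (ηᵀ x - xᵀ Λ x / 2) dx` for positive definite `Λ`, in closed form. -/
def logPartition (θ : Param ι) : ℝ :=
  (1 / 2) * (θ.1 ⬝ᵥ (precision θ)⁻¹ *ᵥ θ.1) - (1 / 2) * Real.log (precision θ).det
    + (Fintype.card ι / 2) * Real.log (2 * Real.pi)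

/-- The unnormalised conjugate Normal-Wishart prior: the measure on `{(η, Λ) : Λ ≻ 0}` with
Lebesgue density `exp (t₀ᵀ η - tr(V₀ᵀ Λ) / 2 - n₀ A(η, Λ))`. Since the Gaussian density is
`exp (ηᵀ x - tr(x xᵀ Λ) / 2 - A(η, Λ))`, here `t₀` and `V₀` are paired with `θ` exactly as the
sufficient statistics `x` and `x xᵀ` are. -/
def unnormalizedPrior (t₀ : ι → ℝ) (V₀ : Matrix ι ι ℝ) (n₀ : ℝ) : Measure (Param ι) :=
  (volume.restrict {θ : Param ι | (precision θ).PosDef}).withDensity fun θ =>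
    ENNReal.ofReal (Real.exp
      (t₀ ⬝ᵥ θ.1 - (1 / 2) * (V₀ᵀ * precision θ).trace - n₀ * logPartition θ))

/-- The conjugate Normal-Wishart prior, normalised to total mass one. -/
def prior (t₀ : ι → ℝ) (V₀ : Matrix ι ι ℝ) (n₀ : ℝ) : Measure (Param ι) :=
  (unnormalizedPrior t₀ V₀ n₀ Set.univ)⁻¹ • unnormalizedPrior t₀ V₀ n₀

end

/-- The loss `L(a, θ) = E_{C, h | θ} ‖h + C a‖²`. -/
def loss {d L : ℕ} (a : Fin L → ℝ) (θ : Param (Idx d L)) : ℝ≥0∞ :=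
  ∫⁻ x, ENNReal.ofReal (‖WithLp.toLp 2 (grad x + ctrl x *ᵥ a)‖ ^ 2) ∂(likelihood θ)

/-- A decision rule maps a minibatch of `M` observations `[vec(C_m), h_m]` to a weight vector. -/
abbrev Rule (d L M : ℕ) : Type := (Fin M → Obs d L) → (Fin L → ℝ)

/-- The Bayesian regret of a decision rule under the prior `π`: given `θ` the `M` observations are
independent draws from the likelihood. -/
def bayesRegret {d L M : ℕ} (π : Measure (Param (Idx d L))) (δ : Rule d L M) : ℝ≥0∞ :=
  ∫⁻ θ, ∫⁻ D, loss (δ D) θ ∂(Measure.pi fun _ : Fin M => likelihood θ) ∂π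

/-- The empirical mean of `C_mᵀ C_m`. -/
def meanCC {d L M : ℕ} (D : Fin M → Obs d L) : Matrix (Fin L) (Fin L) ℝ :=
  (1 / (M : ℝ)) • ∑ m, (ctrl (D m))ᵀ * ctrl (D m)

/-- The empirical mean of `C_mᵀ h_m`. -/
def meanCh {d L M : ℕ} (D : Fin M → Obs d L) : Fin L → ℝ :=
  (1 / (M : ℝ)) • ∑ m, (ctrl (D m))ᵀ *ᵥ grad (D m)

/-- The matrix `(d v₀ / M) I + mean of C_mᵀ C_m`. -/
def ridgeMatrix {d L M : ℕ} (v₀ : ℝ) (D : Fin M → Obs d L) : Matrix (Fin L) (Fin L) ℝ :=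
  ((d : ℝ) * v₀ / (M : ℝ)) • (1 : Matrix (Fin L) (Fin L) ℝ) + meanCC D

/-- The rule `-((d v₀ / M) I + mean of C_mᵀ C_m)⁻¹ (mean of C_mᵀ h_m)`. -/
def ridgeRule {d L M : ℕ} (v₀ : ℝ) : Rule d L M :=
  fun D => -((ridgeMatrix v₀ D)⁻¹ *ᵥ meanCh D)

end CVBayes

end

noncomputable section

namespace CVBayes

/-! ### Product densities and the Gaussian likelihood in canonical form. -/

section

open ProbabilityTheory

/-! The family is conjugate: prior density times the likelihood of the data is again an unnormalised
Normal-Wishart density, with parameters `t₀ + ∑ x_m`, `V₀ + ∑ x_m x_mᵀ`, `n₀ + M`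
(`priorDensity_mul_prod_likelihoodDensity`). By Tonelli the regret is therefore an integral over the
data of the posterior expected loss, weighted by the marginal density of the data, and it suffices
to minimise for each data set separately.

The loss is quadratic: `(h + C a) i = v_i ⬝ᵥ x` for an explicit vector `v_i`, so only the posterior
expectation of the second moment of `v ⬝ᵥ x` is needed. For a density with parameters `t, V, n` it
is `vᵀ V v / n` (`lintegral_priorDensity_mul_secondMoment`). The reason is integration by parts in
the direction `v vᵀ` of `Λ`: the logarithmic derivative of the density is `-vᵀ V v / 2` plus `n / 2`
times the second moment, and the total derivative integrates to zero. To avoid boundary terms at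
infinity and differentiation under the integral, the fundamental theorem of calculus is applied on a
segment of length one of each line `Λ + s v vᵀ`, and the result is integrated over all parameters.
Translation invariance of Lebesgue measure makes the two endpoint terms equal and removes `s`. At
the boundary of the positive definite cone the density tends to zero along such a line because of
the factor `(det Λ) ^ (n / 2)`, with `n > 0`.

Summing over `i`, the posterior loss is, up to the factor `n₀ + M`, the ridge objective `d v₀ (‖a‖²
+ 1) + ∑ ‖h_m + C_m a‖²` (`bayesRegret_eq`). Completing the square (`postLoss_eq_add`) gives its
unique minimiser. The marginal density of the data is positive everywhere and finite almost
everywhere, and the minimal regret is finite, so equality of regrets forces equality of the rules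
almost everywhere.

Normalisability of the prior (`lintegral_priorDensity_ne_top`) comes from integrating out `η` and
bounding what remains by an exponential in the trace of `Λ`. -/

theorem lintegral_fin_prod_eq_prod {n : ℕ} {E : Fin n → Type*}
    {mE : ∀ i, MeasurableSpace (E i)} {μ : (i : Fin n) → Measure (E i)} [∀ i, SigmaFinite (μ i)]
    (f : (i : Fin n) → E i → ℝ≥0∞) (hf : ∀ i, Measurable (f i)) :
    ∫⁻ x : (i : Fin n) → E i, ∏ i, f i (x i) ∂(Measure.pi μ) = ∏ i, ∫⁻ x, f i x ∂(μ i) := by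
  induction n with
  | zero => simp
  | succ n n_ih =>
      calc
        _ = ∫⁻ x : E 0 × ((i : Fin n) → E (Fin.succ i)),
            f 0 x.1 * ∏ i : Fin n, f (Fin.succ i) (x.2 i)
            ∂((μ 0).prod (Measure.pi (fun i ↦ μ i.succ))) := by
          refine (((measurePreserving_piFinSuccAbove μ 0).symm).lintegral_comp_emb
            (MeasurableEquiv.measurableEmbedding _) _).symm.trans ?_
          refine lintegral_congr fun x => ?_
          rw [Fin.prod_univ_succ]
          rfl
        _ = (∫⁻ x, f 0 x ∂μ 0)
            * ∏ i : Fin n, ∫⁻ (x : E (Fin.succ i)), f (Fin.succ i) x ∂(μ i.succ) := by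
          rw [← n_ih _ fun i => hf _, ← lintegral_prod_mul (hf 0).aemeasurable]
          exact (Finset.measurable_prod _ fun i _ => (hf _).comp (measurable_pi_apply i)).aemeasurable
        _ = ∏ i, ∫⁻ x, f i x ∂(μ i) := by rw [Fin.prod_univ_succ]

theorem lintegral_fintype_prod_eq_prod {κ : Type*} [Fintype κ] {E : κ → Type*}
    {mE : ∀ i, MeasurableSpace (E i)} {μ : (i : κ) → Measure (E i)} [∀ i, SigmaFinite (μ i)]
    (f : (i : κ) → E i → ℝ≥0∞) (hf : ∀ i, Measurable (f i)) :
    ∫⁻ x : (i : κ) → E i, ∏ i, f i (x i) ∂(Measure.pi μ) = ∏ i, ∫⁻ x, f i x ∂(μ i) := by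
  let e := (Fintype.equivFin κ).symm
  rw [← (measurePreserving_piCongrLeft _ e).lintegral_comp_emb
    (MeasurableEquiv.measurableEmbedding _)]
  simp_rw [← e.prod_comp, MeasurableEquiv.coe_piCongrLeft, Equiv.piCongrLeft_apply_apply]
  exact lintegral_fin_prod_eq_prod (fun i => f (e i)) fun i => hf _

theorem pi_withDensity {κ : Type*} [Fintype κ] {E : κ → Type*}
    {mE : ∀ i, MeasurableSpace (E i)} {μ : (i : κ) → Measure (E i)} [∀ i, SigmaFinite (μ i)]
    (f : (i : κ) → E i → ℝ≥0∞) (hf : ∀ i, Measurable (f i))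
    [∀ i, SigmaFinite ((μ i).withDensity (f i))] :
    Measure.pi (fun i => (μ i).withDensity (f i)) =
      (Measure.pi μ).withDensity fun x => ∏ i, f i (x i) := by
  refine Measure.pi_eq fun s hs => ?_
  rw [withDensity_apply _ (MeasurableSet.univ_pi hs), Measure.restrict_pi_pi,
    lintegral_fintype_prod_eq_prod _ hf]
  exact Finset.prod_congr rfl fun i _ => (withDensity_apply _ (hs i)).symm

variable {ι : Type*} [Fintype ι]

theorem prod_gaussianPDF_eq (x : ι → ℝ) :
    ∏ i, gaussianPDF 0 1 (x i) = ENNReal.ofReal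
      (Real.exp (-(1 / 2) * (x ⬝ᵥ x) - (Fintype.card ι / 2) * Real.log (2 * Real.pi))) := by
  have h (i : ι) : gaussianPDF 0 1 (x i) = ENNReal.ofReal
      (Real.exp (-(1 / 2) * (x i * x i) - (1 / 2) * Real.log (2 * Real.pi))) := by
    rw [gaussianPDF, gaussianPDFReal]
    congr 1
    rw [Real.sqrt_eq_rpow, Real.rpow_def_of_pos (by positivity), ← Real.exp_neg, ← Real.exp_add]
    congr 1
    simp only [NNReal.coe_one, mul_one, sub_zero]
    ring
  simp_rw [h]
  rw [← ENNReal.ofReal_prod_of_nonneg fun _ _ => (Real.exp_pos _).le, ← Real.exp_sum]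
  congr 2
  simp only [Finset.sum_sub_distrib, ← Finset.mul_sum, dotProduct, Finset.sum_const,
    Finset.card_univ, nsmul_eq_mul]
  ring

theorem lintegral_stdGaussian {f : EuclideanSpace ℝ ι → ℝ≥0∞} (hf : Measurable f) :
    ∫⁻ x, f x ∂(stdGaussian (EuclideanSpace ℝ ι)) =
      ∫⁻ x, f x * ENNReal.ofReal (Real.exp (-(1 / 2) * (x.ofLp ⬝ᵥ x.ofLp)
        - (Fintype.card ι / 2) * Real.log (2 * Real.pi))) := by
  have hm : Measurable fun x : ι → ℝ => ENNReal.ofReal (Real.exp (-(1 / 2) * (x ⬝ᵥ x)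
        - (Fintype.card ι / 2) * Real.log (2 * Real.pi))) := by
    simp only [dotProduct]; fun_prop
  rw [← map_pi_eq_stdGaussian, lintegral_map hf (by fun_prop)]
  have hd : gaussianReal 0 1 = volume.withDensity (gaussianPDF 0 1) := by
    simp [gaussianReal]
  have : SigmaFinite ((volume : Measure ℝ).withDensity (gaussianPDF 0 1)) := hd ▸ inferInstance
  rw [hd, pi_withDensity (fun _ => gaussianPDF 0 1) fun _ => measurable_gaussianPDF 0 1]
  simp_rw [prod_gaussianPDF_eq]
  rw [lintegral_withDensity_eq_lintegral_mul _ hm (by fun_prop),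
    ← (PiLp.volume_preserving_toLp ι).lintegral_comp (by fun_prop)]
  simp [volume_pi, mul_comm]

variable [DecidableEq ι]

instance isGaussian_likelihood (θ : Param ι) : IsGaussian (likelihood θ) :=
  isGaussian_multivariateGaussian

/-- The Gaussian is the image of the standard one under `x ↦ m + S x` with `S` the square root of
`Λ⁻¹`. The linear change of variables contributes `(det S)⁻¹ = (det Λ) ^ (1 / 2)`, and expanding the
square around `m = Λ⁻¹ η` produces the log-partition function. -/
theorem likelihood_eq_withDensity {θ : Param ι} (hθ : (precision θ).PosDef) :
    likelihood θ = volume.withDensity fun x => ENNReal.ofReal (Real.exp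
      (θ.1 ⬝ᵥ x.ofLp - (1 / 2) * (x.ofLp ⬝ᵥ precision θ *ᵥ x.ofLp) - logPartition θ)) := by
  open scoped MatrixOrder in
  set Λ := precision θ with hΛ
  set S := CFC.sqrt Λ⁻¹ with hS
  have hSS : S * S = Λ⁻¹ := CFC.sqrt_mul_sqrt_self _ hθ.inv.posSemidef.nonneg
  have hSp : S.PosSemidef := Matrix.nonneg_iff_posSemidef.1 (CFC.sqrt_nonneg Λ⁻¹)
  have hdet : S.det * S.det = (Λ.det)⁻¹ := by
    rw [← Matrix.det_mul, hSS, Matrix.det_nonsing_inv, Ring.inverse_eq_inv']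
  have hΛdet : 0 < Λ.det := hθ.det_pos
  have hSd : 0 < S.det := by
    refine lt_of_le_of_ne hSp.det_nonneg fun h => ?_
    rw [← h] at hdet
    have := inv_pos.2 hΛdet
    linarith
  have hST : Sᵀ = S := by simpa using hSp.isHermitian.eq
  set T := Matrix.toEuclideanCLM (n := ι) (𝕜 := ℝ) S with hT
  have hTdet : LinearMap.det (T : EuclideanSpace ℝ ι →ₗ[ℝ] EuclideanSpace ℝ ι) = S.det := by
    rw [hT, Matrix.coe_toEuclideanCLM_eq_toEuclideanLin, Matrix.toEuclideanLin_eq_toLin_orthonormal,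
      LinearMap.det_toLin]
  set m : EuclideanSpace ℝ ι := WithLp.toLp 2 (Λ⁻¹ *ᵥ θ.1) with hm
  refine Measure.ext_of_lintegral _ fun f hf => ?_
  rw [likelihood, multivariateGaussian, lintegral_map hf (by fun_prop),
    lintegral_stdGaussian (by fun_prop), lintegral_withDensity_eq_lintegral_mul _ _ hf]
  rotate_left
  · simp only [dotProduct, Matrix.mulVec]; fun_prop
  set g : EuclideanSpace ℝ ι → ℝ≥0∞ := fun z => f (m + z) * ENNReal.ofReal
    (Real.exp (-(1 / 2) * (z.ofLp ⬝ᵥ Λ *ᵥ z.ofLp)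
      - (Fintype.card ι / 2) * Real.log (2 * Real.pi))) with hg
  have hgm : Measurable g := by
    simp only [hg, dotProduct, Matrix.mulVec]; fun_prop
  have hΛS : S * Λ * S = 1 := by
    have h1 : Λ⁻¹ * Λ = 1 := Matrix.nonsing_inv_mul _ hΛdet.ne'.isUnit
    have h2 : S * (S * Λ) = 1 := by rw [← Matrix.mul_assoc, hSS, h1]
    exact mul_eq_one_comm.1 h2
  have hcomp : ∀ x : EuclideanSpace ℝ ι, f (m + T x) * ENNReal.ofReal
      (Real.exp (-(1 / 2) * (x.ofLp ⬝ᵥ x.ofLp)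
        - (Fintype.card ι / 2) * Real.log (2 * Real.pi))) = g (T x) := by
    intro x
    have h1 : (T x).ofLp ⬝ᵥ Λ *ᵥ (T x).ofLp = x.ofLp ⬝ᵥ x.ofLp := by
      rw [hT, Matrix.ofLp_toEuclideanCLM, Matrix.mulVec_mulVec, Matrix.dotProduct_mulVec,
        Matrix.vecMul_mulVec, hST, ← Matrix.mul_assoc, hΛS, Matrix.vecMul_one]
    simp only [hg, h1]
  change ∫⁻ x, f (m + T x) * _ = _
  simp_rw [hcomp]
  have hmap := Measure.map_linearMap_addHaar_eq_smul_addHaar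
    (volume : Measure (EuclideanSpace ℝ ι)) (f := (T : EuclideanSpace ℝ ι →ₗ[ℝ] _))
    (by rw [hTdet]; exact hSd.ne')
  have hl : ∫⁻ x, g (T x) = ENNReal.ofReal |S.det⁻¹| * ∫⁻ z, g z := by
    rw [← lintegral_map (f := g) (g := T) hgm (by fun_prop)]
    change ∫⁻ z, g z ∂(Measure.map (T : EuclideanSpace ℝ ι →ₗ[ℝ] _) volume) = _
    rw [hmap, hTdet, lintegral_smul_measure, smul_eq_mul]
  -- Translating by `-m` turns `f (m + z)` into `f x`, after which the densities can be compared
  -- pointwise.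
  rw [hl, ← lintegral_add_left_eq_self _ (-m), ← lintegral_const_mul _ (by fun_prop)]
  refine lintegral_congr fun x => ?_
  simp only [hg, Pi.mul_apply, add_neg_cancel_left]
  rw [mul_comm, mul_assoc, mul_comm, ← ENNReal.ofReal_mul (Real.exp_pos _).le]
  congr 2
  have hΛT : Λᵀ = Λ := by simpa using hθ.isHermitian.eq
  have hΛm : Λ *ᵥ m.ofLp = θ.1 := by
    rw [hm, Matrix.mulVec_mulVec, Matrix.mul_nonsing_inv _ hΛdet.ne'.isUnit, Matrix.one_mulVec]
  have hmm : m.ofLp ⬝ᵥ θ.1 = θ.1 ⬝ᵥ Λ⁻¹ *ᵥ θ.1 := by rw [dotProduct_comm, hm]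
  have hsym : m.ofLp ⬝ᵥ Λ *ᵥ x.ofLp = θ.1 ⬝ᵥ x.ofLp := by
    rw [Matrix.dotProduct_mulVec, ← Matrix.mulVec_transpose, hΛT, hΛm]
  have hS' : |S.det⁻¹| = Real.exp ((1 / 2) * Real.log Λ.det) := by
    rw [abs_of_pos (inv_pos.2 hSd), ← Real.exp_log (inv_pos.2 hSd)]
    congr 1
    have := congrArg Real.log hdet
    rw [Real.log_mul hSd.ne' hSd.ne', Real.log_inv] at this
    rw [Real.log_inv]
    linarith
  rw [hS', ← Real.exp_add]
  congr 1
  rw [WithLp.ofLp_add, WithLp.ofLp_neg, Matrix.mulVec_add, Matrix.mulVec_neg, add_dotProduct,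
    dotProduct_add, dotProduct_add, neg_dotProduct, neg_dotProduct, hΛm, hsym, dotProduct_neg,
    dotProduct_neg, hmm, logPartition, dotProduct_comm x.ofLp θ.1]
  ring

/-- Variance plus squared mean of the linear functional `v`. -/
theorem lintegral_sq_likelihood {θ : Param ι} (hθ : (precision θ).PosDef) (v : ι → ℝ) :
    ∫⁻ x, ENNReal.ofReal ((v ⬝ᵥ x.ofLp) ^ 2) ∂(likelihood θ) = ENNReal.ofReal
      (v ⬝ᵥ (precision θ)⁻¹ *ᵥ v + (v ⬝ᵥ (precision θ)⁻¹ *ᵥ θ.1) ^ 2) := by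
  set μ : EuclideanSpace ℝ ι := WithLp.toLp 2 ((precision θ)⁻¹ *ᵥ θ.1) with hμ
  have hv (x : EuclideanSpace ℝ ι) :
      v ⬝ᵥ x.ofLp = innerSL ℝ (WithLp.toLp 2 v : EuclideanSpace ℝ ι) x := by
    simp [PiLp.inner_apply, dotProduct, mul_comm]
  have hL : MemLp (fun x : EuclideanSpace ℝ ι => v ⬝ᵥ x.ofLp) 2 (likelihood θ) := by
    simp_rw [hv]
    exact IsGaussian.memLp_dual (likelihood θ) _ 2 (by simp)
  rw [← ofReal_integral_eq_lintegral_ofReal hL.integrable_sq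
    (Filter.Eventually.of_forall fun x => sq_nonneg _)]
  congr 1
  have h2 : Var[fun x : EuclideanSpace ℝ ι => v ⬝ᵥ x.ofLp; likelihood θ]
      = v ⬝ᵥ (precision θ)⁻¹ *ᵥ v := by
    rw [← covariance_self hL.aemeasurable]
    have := covarianceBilin_multivariateGaussian (μ := μ) hθ.inv.posSemidef (WithLp.toLp 2 v)
      (WithLp.toLp 2 v)
    rw [covarianceBilin_apply_eq_cov IsGaussian.memLp_two_id] at this
    simpa [likelihood, ← hμ, PiLp.inner_apply, dotProduct, mul_comm] using this
  have h1 : ∫ x, v ⬝ᵥ x.ofLp ∂(likelihood θ) = v ⬝ᵥ (precision θ)⁻¹ *ᵥ θ.1 := by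
    simp_rw [fun x => hv x]
    rw [ContinuousLinearMap.integral_comp_comm _ (IsGaussian.integrable_fun_id
      (μ := likelihood θ)), likelihood, integral_id_multivariateGaussian, ← hv]
  rw [← h1, ← h2, variance_eq_sub hL]
  simp [Pi.pow_apply]

end

/-! ### One-dimensional calculus along a line in the parameter space. -/

section

open Set Filter Topology

/-- Fundamental theorem of calculus for `f' = P - b f` with nonnegative terms; the integrability of
`P` is part of the conclusion. -/
theorem ofReal_add_setLIntegral_of_hasDerivAt {f P : ℝ → ℝ} {a b : ℝ} (ha : a ≤ 0) (hb : 0 ≤ b)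
    (hf : ∀ s, 0 ≤ f s) (hP : ∀ s, 0 ≤ P s) (hcont : ContinuousOn f (Icc a 0))
    (hderiv : ∀ s ∈ Ioo a 0, HasDerivAt f (P s - b * f s) s) :
    ENNReal.ofReal (f 0) + ∫⁻ s in Ioc a 0, ENNReal.ofReal (b * f s) =
      ENNReal.ofReal (f a) + ∫⁻ s in Ioc a 0, ENNReal.ofReal (P s) := by
  have hint : IntervalIntegrable (fun s => b * f s) volume a 0 :=
    (hcont.const_mul b |>.mono (by rw [uIcc_of_le ha])).intervalIntegrable
  -- In the application `P` can be unbounded near `a` (when `n < 2` and `w = 0`). Its integrability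
  -- follows because it is the nonnegative derivative of `f + ∫ b f`, which is continuous up to the
  -- endpoints.
  have hPint : IntegrableOn P (Ioc a 0) := by
    refine intervalIntegral.integrableOn_deriv_of_nonneg
      (g := fun s => f s + ∫ u in a..s, b * f u) ?_ (fun s hs => ?_) fun s _ => hP s
    · refine hcont.add ?_
      have := intervalIntegral.continuousOn_primitive_interval
        (μ := volume) (f := fun s => b * f s) (a := a) (b := 0)
        (by rw [uIcc_of_le ha]; exact (hcont.const_mul b).integrableOn_Icc)
      rwa [uIcc_of_le ha] at this
    · have h2 : HasDerivAt (fun s => ∫ u in a..s, b * f u) (b * f s) s := by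
        refine intervalIntegral.integral_hasDerivAt_right (hint.mono_set ?_) ?_ ?_
        · rw [uIcc_of_le ha, uIcc_of_le hs.1.le]; exact Icc_subset_Icc_right hs.2.le
        · exact ((hcont.const_mul b).mono Ioo_subset_Icc_self).stronglyMeasurableAtFilter
            isOpen_Ioo s hs
        · exact (hcont.const_mul b).continuousAt (Icc_mem_nhds hs.1 hs.2)
      exact ((hderiv s hs).add h2).congr_deriv (by ring)
  have hPi : IntervalIntegrable P volume a 0 :=
    (intervalIntegrable_iff_integrableOn_Ioc_of_le ha).2 hPint
  have hftc := intervalIntegral.integral_eq_sub_of_hasDerivAt_of_le ha hcont hderiv (hPi.sub hint)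
  rw [intervalIntegral.integral_sub hPi hint, intervalIntegral.integral_of_le ha,
    intervalIntegral.integral_of_le ha] at hftc
  rw [← ofReal_integral_eq_lintegral_ofReal hPint (Eventually.of_forall hP),
    ← ofReal_integral_eq_lintegral_ofReal hint.1
      (Eventually.of_forall fun s => mul_nonneg hb (hf s)),
    ← ENNReal.ofReal_add (hf _) (integral_nonneg fun s => mul_nonneg hb (hf s)),
    ← ENNReal.ofReal_add (hf _) (integral_nonneg hP)]
  congr 1
  linarith

/-- The density of the prior along the line `Λ + s v vᵀ`, as a function of `s`. -/
def lineDensity (r w b n c s : ℝ) : ℝ :=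
  if 0 < 1 + s * r then
    Real.exp (c - b * s + n / 2 * (s * w ^ 2 / (1 + s * r) + Real.log (1 + s * r)))
  else 0

theorem lineDensity_nonneg (r w b n c s : ℝ) : 0 ≤ lineDensity r w b n c s := by
  unfold lineDensity; split_ifs <;> positivity

theorem lineDensity_of_nonpos {r w b n c s : ℝ} (h : 1 + s * r ≤ 0) :
    lineDensity r w b n c s = 0 := if_neg h.not_gt

theorem hasDerivAt_lineDensity {r w b n c s : ℝ} (h : 0 < 1 + s * r) :
    HasDerivAt (lineDensity r w b n c) (lineDensity r w b n c s *
      (n / 2 * (r / (1 + s * r) + (w / (1 + s * r)) ^ 2)) - b * lineDensity r w b n c s) s := by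
  have h0 : HasDerivAt (fun s : ℝ => 1 + s * r) r s := by
    simpa using ((hasDerivAt_id s).mul_const r).const_add 1
  have h1 : HasDerivAt (fun s : ℝ => s * w ^ 2 / (1 + s * r))
      ((w ^ 2 * (1 + s * r) - s * w ^ 2 * r) / (1 + s * r) ^ 2) s := by
    exact (((hasDerivAt_id s).mul_const (w ^ 2)).div h0 h.ne').congr_deriv (by simp)
  have h2 := ((((hasDerivAt_id s).const_mul b).const_sub c).add
    ((h1.add (h0.log h.ne')).const_mul (n / 2))).exp
  have heq : lineDensity r w b n c =ᶠ[𝓝 s] fun s =>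
      Real.exp (c - b * s + n / 2 * (s * w ^ 2 / (1 + s * r) + Real.log (1 + s * r))) := by
    filter_upwards [h0.continuousAt.eventually (lt_mem_nhds h)] with x hx
    exact if_pos hx
  refine (h2.congr_of_eventuallyEq heq).congr_deriv ?_
  simp only [lineDensity, if_pos h, id, Pi.add_apply]
  have := h.ne'
  field_simp
  ring

theorem continuousOn_lineDensity {r w b n c : ℝ} (hb : 0 ≤ b) (hn : 0 < n) :
    ContinuousOn (lineDensity r w b n c) (Icc (-1) 0) := by
  intro s hs
  have h0 : Continuous fun s : ℝ => 1 + s * r := by fun_prop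
  rcases lt_trichotomy 0 (1 + s * r) with h | h | h
  · exact (hasDerivAt_lineDensity h).continuousAt.continuousWithinAt
  · rw [ContinuousWithinAt, lineDensity_of_nonpos h.ge]
    -- At the edge of the cone: since `-1 ≤ s ≤ 0`, the term in `w ^ 2` is nonpositive and `-b s ≤
    -- b`, which leaves this upper bound. It vanishes in the limit because `n > 0`.
    have hup : Tendsto (fun s => Real.exp (c + b) * (max (1 + s * r) 0) ^ (n / 2))
        (𝓝[Icc (-1) 0] s) (𝓝 0) := by
      have : Continuous fun s => Real.exp (c + b) * (max (1 + s * r) 0) ^ (n / 2) :=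
        continuous_const.mul ((h0.max continuous_const).rpow_const fun _ => Or.inr (by positivity))
      convert this.continuousWithinAt.tendsto using 2
      rw [← h, max_self, Real.zero_rpow (by positivity), mul_zero]
    refine tendsto_of_tendsto_of_tendsto_of_le_of_le' tendsto_const_nhds hup
      (Eventually.of_forall fun x => lineDensity_nonneg _ _ _ _ _ x) ?_
    filter_upwards [self_mem_nhdsWithin] with x hx
    unfold lineDensity
    split_ifs with hpos
    · rw [max_eq_left hpos.le, Real.rpow_def_of_pos hpos, ← Real.exp_add, Real.exp_le_exp]
      have h1 : x * w ^ 2 / (1 + x * r) ≤ 0 :=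
        div_nonpos_of_nonpos_of_nonneg (mul_nonpos_of_nonpos_of_nonneg hx.2 (sq_nonneg w)) hpos.le
      nlinarith [hx.1]
    · positivity
  · refine ContinuousAt.continuousWithinAt ?_
    have heq : lineDensity r w b n c =ᶠ[𝓝 s] fun _ => 0 := by
      filter_upwards [h0.continuousAt.eventually (gt_mem_nhds h)] with x hx
      exact lineDensity_of_nonpos (le_of_lt hx)
    exact continuousAt_const.congr heq.symm

/-- Integration of `f' = P - b f` over `[-1, 0]`, arranged with nonnegative terms on both sides so
that it can later be integrated over `θ` without integrability conditions. -/
theorem lineDensity_identity {r w b n c : ℝ} (hr : 0 ≤ r) (hb : 0 ≤ b) (hn : 0 < n) :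
    ENNReal.ofReal (lineDensity r w b n c 0)
        + ∫⁻ s in Ioc (-1) 0, ENNReal.ofReal (b * lineDensity r w b n c s) =
      ENNReal.ofReal (lineDensity r w b n c (-1))
        + ∫⁻ s in Ioc (-1) 0, ENNReal.ofReal (lineDensity r w b n c s *
          (n / 2 * (r / (1 + s * r) + (w / (1 + s * r)) ^ 2))) := by
  set f := lineDensity r w b n c with hf
  set P : ℝ → ℝ := fun s => f s * (n / 2 * (r / (1 + s * r) + (w / (1 + s * r)) ^ 2)) with hP
  have hf0 : ∀ s, 0 ≤ f s := lineDensity_nonneg _ _ _ _ _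
  have hP0 : ∀ s, 0 ≤ P s := by
    intro s
    by_cases h : 0 < 1 + s * r
    · have := hf0 s
      simp only [hP]; positivity
    · simp [hP, hf, lineDensity_of_nonpos (not_lt.1 h)]
  have hcont : ContinuousOn f (Icc (-1) 0) := continuousOn_lineDensity hb hn
  -- Going backwards from `0`, the line leaves the cone at `-1 / r`. If that is below `-1`, or `r =
  -- 0`, the whole interval is used; otherwise the calculus is done on `[-1 / r, 0]` and the density
  -- is zero on the rest.
  obtain ⟨a, ha1, ha0, hpos, hneg⟩ : ∃ a : ℝ, -1 ≤ a ∧ a ≤ 0 ∧ (∀ s, a < s → s ≤ 0 → 0 < 1 + s * r) ∧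
      (a = -1 ∨ ∀ s ≤ a, 1 + s * r ≤ 0) := by
    rcases lt_or_ge r 1 with h | h
    · exact ⟨-1, le_rfl, by norm_num, fun s h1 h2 => by nlinarith, Or.inl rfl⟩
    · have hr0 : 0 < r := by linarith
      have hinv : -r⁻¹ * r = -1 := by field_simp
      refine ⟨-r⁻¹, neg_le_neg (inv_le_one_of_one_le₀ h), by simp [hr], fun s h1 h2 => ?_,
        Or.inr fun s hs => ?_⟩ <;> nlinarith
  have key := ofReal_add_setLIntegral_of_hasDerivAt (P := P) ha0 hb hf0 hP0
    (hcont.mono (Icc_subset_Icc_left ha1))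
    fun s hs => hasDerivAt_lineDensity (hpos s hs.1 hs.2.le)
  rcases hneg with rfl | hneg
  · exact key
  · have hz : ∀ s ≤ a, f s = 0 := fun s hs => lineDensity_of_nonpos (hneg s hs)
    have hsplit (g : ℝ → ℝ) (hg : ∀ s ≤ a, g s = 0) : ∫⁻ s in Ioc (-1) 0, ENNReal.ofReal (g s) =
        ∫⁻ s in Ioc a 0, ENNReal.ofReal (g s) := by
      rw [← Ioc_union_Ioc_eq_Ioc ha1 ha0, lintegral_union measurableSet_Ioc
        (Ioc_disjoint_Ioc_of_le le_rfl), setLIntegral_eq_zero measurableSet_Ioc, zero_add]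
      exact fun s hs => by simp [hg s hs.2]
    rw [hsplit (fun s => b * f s) fun s hs => by simp [hz s hs],
      hsplit P fun s hs => by simp [hP, hz s hs], key, hz a le_rfl, hz (-1) ha1]

end

/-! ### Rank-one perturbations of the precision matrix, and measurability. -/

section

open Set Filter Topology

variable {ι : Type*}

/-- The free entries of the rank-one matrix `v vᵀ`. -/
def rankOne (v : ι → ℝ) : Sym2 ι → ℝ :=
  Sym2.lift ⟨fun i j => v i * v j, fun i j => mul_comm (v i) (v j)⟩

theorem precision_add_smul_rankOne (θ : Param ι) (v : ι → ℝ) (s : ℝ) :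
    precision (θ + s • ((0 : ι → ℝ), rankOne v)) = precision θ + s • Matrix.vecMulVec v v := by
  ext i j
  simp [precision, symMatrix, rankOne, Matrix.vecMulVec]

theorem precision_transpose (θ : Param ι) : (precision θ)ᵀ = precision θ := by
  ext i j
  simp [precision, symMatrix, Sym2.eq_swap]

theorem continuous_precision : Continuous (precision : Param ι → Matrix ι ι ℝ) := by
  unfold precision symMatrix
  refine continuous_matrix fun i j => ?_
  simp only [Matrix.of_apply]
  fun_prop

variable [Fintype ι]

theorem posDef_precision_iff (θ : Param ι) :
    (precision θ).PosDef ↔ ∀ x : ι → ℝ, x ≠ 0 → 0 < x ⬝ᵥ precision θ *ᵥ x := by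
  rw [Matrix.posDef_iff_dotProduct_mulVec]
  refine ⟨fun h x hx => by simpa using h.2 hx, fun h => ⟨?_, fun x hx => by simpa using h x hx⟩⟩
  rw [Matrix.IsHermitian, Matrix.conjTranspose_eq_transpose_of_trivial, precision_transpose]

theorem posSemidef_precision_iff (θ : Param ι) :
    (precision θ).PosSemidef ↔ ∀ x : ι → ℝ, 0 ≤ x ⬝ᵥ precision θ *ᵥ x := by
  rw [Matrix.posSemidef_iff_dotProduct_mulVec]
  refine ⟨fun h x => by simpa using h.2 x, fun h => ⟨?_, fun x => by simpa using h x⟩⟩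
  rw [Matrix.IsHermitian, Matrix.conjTranspose_eq_transpose_of_trivial, precision_transpose]

theorem dotProduct_vecMulVec_mulVec (x v : ι → ℝ) :
    x ⬝ᵥ Matrix.vecMulVec v v *ᵥ x = (v ⬝ᵥ x) ^ 2 := by
  rw [Matrix.vecMulVec_mulVec, dotProduct_comm x]
  simp [sq, dotProduct_comm]

theorem PosDef.add_smul_rankOne {θ : Param ι} (h : (precision θ).PosDef) (v : ι → ℝ) {s : ℝ}
    (hs : 0 ≤ s) : (precision (θ + s • ((0 : ι → ℝ), rankOne v))).PosDef := by
  rw [posDef_precision_iff] at h ⊢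
  intro x hx
  rw [precision_add_smul_rankOne, Matrix.add_mulVec, Matrix.smul_mulVec, dotProduct_add,
    dotProduct_smul, dotProduct_vecMulVec_mulVec, smul_eq_mul]
  have := h x hx
  positivity

variable [DecidableEq ι]

theorem measurable_det_precision : Measurable fun θ : Param ι => (precision θ).det :=
  continuous_precision.matrix_det.measurable

theorem measurable_inv_precision_apply (i j : ι) :
    Measurable fun θ : Param ι => (precision θ)⁻¹ i j := by
  simp only [Matrix.inv_def, Matrix.smul_apply, smul_eq_mul, Ring.inverse_eq_inv']
  exact measurable_det_precision.inv.mul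
    (continuous_precision.matrix_adjugate.matrix_elem i j).measurable

theorem measurable_inv_form {α : Type*} [MeasurableSpace α] {u w : α → ι → ℝ} {θ : α → Param ι}
    (hu : Measurable u) (hw : Measurable w) (hθ : Measurable θ) :
    Measurable fun a => u a ⬝ᵥ (precision (θ a))⁻¹ *ᵥ w a := by
  simp only [dotProduct, Matrix.mulVec]
  exact Finset.measurable_sum _ fun i _ => (measurable_pi_iff.1 hu i).mul
    (Finset.measurable_sum _ fun j _ =>
      ((measurable_inv_precision_apply i j).comp hθ).mul (measurable_pi_iff.1 hw j))

theorem measurable_logPartition : Measurable (logPartition : Param ι → ℝ) :=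
  (((measurable_inv_form measurable_fst measurable_fst measurable_id).const_mul _).sub
    ((Real.measurable_log.comp measurable_det_precision).const_mul _)).add_const _

theorem measurableSet_posDef : MeasurableSet {θ : Param ι | (precision θ).PosDef} := by
  -- A closed condition (positive semidefinite) intersected with the nonvanishing of a continuous
  -- function.
  have h : {θ : Param ι | (precision θ).PosDef} =
      {θ | ∀ x : ι → ℝ, 0 ≤ x ⬝ᵥ precision θ *ᵥ x} ∩ {θ | (precision θ).det ≠ 0} := by
    ext θ
    simp only [mem_ofPred_eq, mem_inter_iff, ← posSemidef_precision_iff]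
    exact ⟨fun h => ⟨h.posSemidef, h.det_pos.ne'⟩, fun h => h.1.posDef_iff_det_ne_zero.2 h.2⟩
  rw [h]
  refine MeasurableSet.inter (IsClosed.measurableSet ?_)
    (measurable_det_precision (measurableSet_singleton 0).compl)
  simp only [ofPred_forall]
  refine isClosed_iInter fun x => isClosed_le continuous_const ?_
  exact continuous_const.dotProduct (continuous_precision.matrix_mulVec continuous_const)

/-- The Lebesgue density of the unnormalised Normal-Wishart prior. -/
def priorDensity (t : ι → ℝ) (V : Matrix ι ι ℝ) (n : ℝ) : Param ι → ℝ≥0∞ :=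
  {θ : Param ι | (precision θ).PosDef}.indicator fun θ => ENNReal.ofReal (Real.exp
    (t ⬝ᵥ θ.1 - (1 / 2) * (Vᵀ * precision θ).trace - n * logPartition θ))

/-- The second moment of `v ⬝ᵥ x` under the likelihood. -/
def secondMoment (v : ι → ℝ) (θ : Param ι) : ℝ :=
  v ⬝ᵥ (precision θ)⁻¹ *ᵥ v + (v ⬝ᵥ (precision θ)⁻¹ *ᵥ θ.1) ^ 2

theorem measurable_priorDensity_comp {α : Type*} [MeasurableSpace α] {t : α → ι → ℝ}
    {V : α → Matrix ι ι ℝ} {θ : α → Param ι} (n : ℝ) (ht : Measurable t)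
    (hV : ∀ i j, Measurable fun a => V a i j) (hθ : Measurable θ) :
    Measurable fun a => priorDensity (t a) (V a) n (θ a) := by
  have h : Measurable fun a => ENNReal.ofReal (Real.exp (t a ⬝ᵥ (θ a).1
      - (1 / 2) * ((V a)ᵀ * precision (θ a)).trace - n * logPartition (θ a))) := by
    refine (Real.measurable_exp.comp (Measurable.sub (Measurable.sub ?_ (Measurable.const_mul ?_ _))
      ((measurable_logPartition.comp hθ).const_mul n))).ennreal_ofReal
    · exact Finset.measurable_sum _ fun i _ => (measurable_pi_iff.1 ht i).mul
        (measurable_pi_iff.1 hθ.fst i)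
    · simp only [Matrix.trace, Matrix.mul_apply, Matrix.diag_apply, Matrix.transpose_apply]
      exact Finset.measurable_sum _ fun i _ => Finset.measurable_sum _ fun j _ => (hV j i).mul
        ((continuous_precision.matrix_elem j i).measurable.comp hθ)
  exact h.indicator (hθ measurableSet_posDef)

theorem measurable_priorDensity (t : ι → ℝ) (V : Matrix ι ι ℝ) (n : ℝ) :
    Measurable (priorDensity t V n) :=
  measurable_priorDensity_comp n measurable_const (fun _ _ => measurable_const) measurable_id

theorem measurable_secondMoment_comp {α : Type*} [MeasurableSpace α] {v : α → ι → ℝ}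
    {θ : α → Param ι} (hv : Measurable v) (hθ : Measurable θ) :
    Measurable fun a => secondMoment (v a) (θ a) :=
  (measurable_inv_form hv hv hθ).add ((measurable_inv_form hv hθ.fst hθ).pow_const 2)

theorem measurable_secondMoment (v : ι → ℝ) : Measurable (secondMoment v) :=
  measurable_secondMoment_comp measurable_const measurable_id

/-- Matrix determinant lemma. -/
theorem det_add_smul_vecMulVec {Λ : Matrix ι ι ℝ} (hΛ : Λ.PosDef) (v : ι → ℝ) (s : ℝ) :
    (Λ + s • Matrix.vecMulVec v v).det = Λ.det * (1 + s * (v ⬝ᵥ Λ⁻¹ *ᵥ v)) := by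
  have h := Matrix.det_add_replicateCol_mul_replicateRow (ι := Unit) hΛ.det_pos.ne'.isUnit (s • v) v
  rw [← Matrix.vecMulVec_eq, Matrix.smul_vecMulVec] at h
  rw [h, Matrix.mul_assoc, ← Matrix.replicateCol_mulVec, Matrix.det_unique (n := Unit)]
  simp [Matrix.mulVec_smul]

/-- Sherman–Morrison formula. -/
theorem inv_add_smul_vecMulVec {Λ : Matrix ι ι ℝ} (hΛ : Λ.PosDef) (v : ι → ℝ) {s : ℝ}
    (h : 1 + s * (v ⬝ᵥ Λ⁻¹ *ᵥ v) ≠ 0) :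
    (Λ + s • Matrix.vecMulVec v v)⁻¹ = Λ⁻¹ - (s / (1 + s * (v ⬝ᵥ Λ⁻¹ *ᵥ v))) •
      Matrix.vecMulVec (Λ⁻¹ *ᵥ v) (Λ⁻¹ *ᵥ v) := by
  refine Matrix.inv_eq_right_inv ?_
  have h1 : Λ * Λ⁻¹ = 1 := Matrix.mul_nonsing_inv _ hΛ.det_pos.ne'.isUnit
  have hT : (Λ⁻¹)ᵀ = Λ⁻¹ := by simpa using hΛ.inv.isHermitian.eq
  have h2 : Λ *ᵥ Λ⁻¹ *ᵥ v = v := by rw [Matrix.mulVec_mulVec, h1, Matrix.one_mulVec]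
  have h3 : v ᵥ* Λ⁻¹ = Λ⁻¹ *ᵥ v := by rw [← Matrix.mulVec_transpose, hT]
  rw [add_mul, mul_sub, mul_sub, h1, Matrix.mul_smul, Matrix.mul_smul, Matrix.smul_mul,
    Matrix.smul_mul, Matrix.mul_vecMulVec, Matrix.vecMulVec_mul, Matrix.vecMulVec_mul_vecMulVec,
    h2, h3]
  ext i j
  simp [Matrix.vecMulVec]
  field_simp
  ring

end

/-! ### Posterior second moments by integration by parts in the direction `v vᵀ`. -/

section

open Set Filter Topology

variable {ι : Type*} [Fintype ι]

theorem trace_transpose_mul_vecMulVec (V : Matrix ι ι ℝ) (v : ι → ℝ) :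
    (Vᵀ * Matrix.vecMulVec v v).trace = v ⬝ᵥ V *ᵥ v := by
  rw [Matrix.mul_vecMulVec, Matrix.trace_vecMulVec, Matrix.mulVec_transpose,
    ← Matrix.dotProduct_mulVec]

variable [DecidableEq ι]

theorem dotProduct_inv_comm {Λ : Matrix ι ι ℝ} (hΛ : Λ.PosDef) (u v : ι → ℝ) :
    u ⬝ᵥ Λ⁻¹ *ᵥ v = v ⬝ᵥ Λ⁻¹ *ᵥ u := by
  have hT : (Λ⁻¹)ᵀ = Λ⁻¹ := by simpa using hΛ.inv.isHermitian.eq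
  rw [Matrix.dotProduct_mulVec, ← Matrix.mulVec_transpose, hT, dotProduct_comm]

/-- Cauchy–Schwarz for the dual forms of `Λ⁻¹` and `Λ`: the discriminant of `l ↦ (x - l Λ⁻¹ v)ᵀ Λ (x
- l Λ⁻¹ v)` is nonpositive. -/
theorem sq_dotProduct_le {Λ : Matrix ι ι ℝ} (hΛ : Λ.PosDef) (v x : ι → ℝ) :
    (v ⬝ᵥ x) ^ 2 ≤ (v ⬝ᵥ Λ⁻¹ *ᵥ v) * (x ⬝ᵥ Λ *ᵥ x) := by
  have h2 : Λ *ᵥ Λ⁻¹ *ᵥ v = v := by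
    rw [Matrix.mulVec_mulVec, Matrix.mul_nonsing_inv _ hΛ.det_pos.ne'.isUnit, Matrix.one_mulVec]
  have hT : Λᵀ = Λ := by simpa using hΛ.isHermitian.eq
  have h3 : (Λ⁻¹ *ᵥ v) ⬝ᵥ Λ *ᵥ x = v ⬝ᵥ x := by
    rw [Matrix.dotProduct_mulVec, ← Matrix.mulVec_transpose, hT, h2]
  have h := discrim_le_zero (a := v ⬝ᵥ Λ⁻¹ *ᵥ v) (b := -2 * (v ⬝ᵥ x)) (c := x ⬝ᵥ Λ *ᵥ x)
    fun l => by
      have := hΛ.posSemidef.dotProduct_mulVec_nonneg (x - l • Λ⁻¹ *ᵥ v)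
      simp only [star_trivial, Matrix.mulVec_sub, Matrix.mulVec_smul, sub_dotProduct,
        dotProduct_sub, smul_dotProduct, dotProduct_smul, h2, h3, smul_eq_mul] at this
      rw [dotProduct_comm x v, dotProduct_comm (Λ⁻¹ *ᵥ v) v] at this
      linarith
  unfold discrim at h
  linarith

/-- Necessity is the sign of the determinant. For negative `s`, sufficiency is Cauchy–Schwarz, which
bounds the perturbed form below by `1 + s vᵀ Λ⁻¹ v` times the original one. -/
theorem posDef_add_smul_rankOne_iff {θ : Param ι} (h : (precision θ).PosDef) (v : ι → ℝ) (s : ℝ) :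
    (precision (θ + s • ((0 : ι → ℝ), rankOne v))).PosDef ↔
      0 < 1 + s * (v ⬝ᵥ (precision θ)⁻¹ *ᵥ v) := by
  refine ⟨fun hs => ?_, fun hs => ?_⟩
  · have := hs.det_pos
    rw [precision_add_smul_rankOne, det_add_smul_vecMulVec h] at this
    exact (mul_pos_iff_of_pos_left h.det_pos).1 this
  · rcases le_or_gt 0 s with h0 | h0
    · exact PosDef.add_smul_rankOne h v h0
    · rw [posDef_precision_iff]
      intro x hx
      have hq := (posDef_precision_iff θ).1 h x hx
      have hc := sq_dotProduct_le h v x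
      rw [precision_add_smul_rankOne, Matrix.add_mulVec, Matrix.smul_mulVec, dotProduct_add,
        dotProduct_smul, dotProduct_vecMulVec_mulVec, smul_eq_mul]
      nlinarith [mul_pos hs hq, mul_le_mul_of_nonpos_left hc h0.le]

theorem inv_form_add_smul_rankOne {θ : Param ι} (h : (precision θ).PosDef) (v a b : ι → ℝ) {s : ℝ}
    (hs : 0 < 1 + s * (v ⬝ᵥ (precision θ)⁻¹ *ᵥ v)) :
    a ⬝ᵥ (precision (θ + s • ((0 : ι → ℝ), rankOne v)))⁻¹ *ᵥ b = a ⬝ᵥ (precision θ)⁻¹ *ᵥ b -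
      s / (1 + s * (v ⬝ᵥ (precision θ)⁻¹ *ᵥ v)) *
        ((v ⬝ᵥ (precision θ)⁻¹ *ᵥ a) * (v ⬝ᵥ (precision θ)⁻¹ *ᵥ b)) := by
  rw [precision_add_smul_rankOne, inv_add_smul_vecMulVec h v hs.ne', Matrix.sub_mulVec,
    Matrix.smul_mulVec, dotProduct_sub, dotProduct_smul, Matrix.vecMulVec_mulVec]
  simp only [MulOpposite.smul_eq_mul_unop, MulOpposite.unop_op, dotProduct_smul, smul_eq_mul]
  rw [dotProduct_inv_comm h a v, dotProduct_comm ((precision θ)⁻¹ *ᵥ v) b,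
    dotProduct_inv_comm h b v]

theorem priorDensity_add_smul_rankOne (t : ι → ℝ) (V : Matrix ι ι ℝ) (n : ℝ) {θ : Param ι}
    (h : (precision θ).PosDef) (v : ι → ℝ) (s : ℝ) :
    priorDensity t V n (θ + s • ((0 : ι → ℝ), rankOne v)) = ENNReal.ofReal
      (lineDensity (v ⬝ᵥ (precision θ)⁻¹ *ᵥ v) (v ⬝ᵥ (precision θ)⁻¹ *ᵥ θ.1)
        (1 / 2 * (v ⬝ᵥ V *ᵥ v)) n
        (t ⬝ᵥ θ.1 - (1 / 2) * (Vᵀ * precision θ).trace - n * logPartition θ) s) := by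
  by_cases hs : 0 < 1 + s * (v ⬝ᵥ (precision θ)⁻¹ *ᵥ v)
  · rw [priorDensity, indicator_of_mem (show _ ∈ {θ : Param ι | (precision θ).PosDef} from
      (posDef_add_smul_rankOne_iff h v s).2 hs), lineDensity, if_pos hs]
    congr 2
    have hη : (θ + s • ((0 : ι → ℝ), rankOne v)).1 = θ.1 := by simp
    rw [logPartition, hη, inv_form_add_smul_rankOne h _ _ _ hs, precision_add_smul_rankOne,
      det_add_smul_vecMulVec h, Real.log_mul h.det_pos.ne' hs.ne', mul_add, Matrix.trace_add,
      Matrix.mul_smul, Matrix.trace_smul, trace_transpose_mul_vecMulVec, logPartition, smul_eq_mul]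
    ring
  · rw [lineDensity_of_nonpos (not_lt.1 hs), ENNReal.ofReal_zero, priorDensity,
      indicator_of_notMem]
    exact fun hmem => hs ((posDef_add_smul_rankOne_iff h v s).1 hmem)

theorem secondMoment_add_smul_rankOne {θ : Param ι} (h : (precision θ).PosDef) (v : ι → ℝ) {s : ℝ}
    (hs : 0 < 1 + s * (v ⬝ᵥ (precision θ)⁻¹ *ᵥ v)) :
    secondMoment v (θ + s • ((0 : ι → ℝ), rankOne v)) =
      (v ⬝ᵥ (precision θ)⁻¹ *ᵥ v) / (1 + s * (v ⬝ᵥ (precision θ)⁻¹ *ᵥ v)) +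
        ((v ⬝ᵥ (precision θ)⁻¹ *ᵥ θ.1) / (1 + s * (v ⬝ᵥ (precision θ)⁻¹ *ᵥ v))) ^ 2 := by
  have hη : (θ + s • ((0 : ι → ℝ), rankOne v)).1 = θ.1 := by simp
  rw [secondMoment, inv_form_add_smul_rankOne h _ _ _ hs, inv_form_add_smul_rankOne h _ _ _ hs, hη]
  have := hs.ne'
  generalize v ⬝ᵥ (precision θ)⁻¹ *ᵥ v = r at *
  generalize v ⬝ᵥ (precision θ)⁻¹ *ᵥ θ.1 = w at *
  obtain ⟨D, hD⟩ : ∃ D, D = 1 + s * r := ⟨_, rfl⟩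
  rw [← hD] at this ⊢
  have h1 : r - s / D * (r * r) = r / D := by
    field_simp
    rw [hD]
    ring
  have h2 : w - s / D * (r * w) = w / D := by
    field_simp
    rw [hD]
    ring
  rw [h1, h2]

theorem priorDensity_line_identity (t : ι → ℝ) {V : Matrix ι ι ℝ} {n : ℝ} (hn : 0 < n) {v : ι → ℝ}
    (hV : 0 ≤ v ⬝ᵥ V *ᵥ v) (θ : Param ι) :
    priorDensity t V n θ + ∫⁻ s in Ioc (-1 : ℝ) 0, ENNReal.ofReal (1 / 2 * (v ⬝ᵥ V *ᵥ v)) *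
        priorDensity t V n (θ + s • ((0 : ι → ℝ), rankOne v)) =
      priorDensity t V n (θ + (-1 : ℝ) • ((0 : ι → ℝ), rankOne v)) +
        ∫⁻ s in Ioc (-1 : ℝ) 0, ENNReal.ofReal (n / 2) *
          (priorDensity t V n (θ + s • ((0 : ι → ℝ), rankOne v)) *
            ENNReal.ofReal (secondMoment v (θ + s • ((0 : ι → ℝ), rankOne v)))) := by
  by_cases h : (precision θ).PosDef
  · have hr : 0 ≤ v ⬝ᵥ (precision θ)⁻¹ *ᵥ v := by
      simpa using h.inv.posSemidef.dotProduct_mulVec_nonneg v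
    have hb : 0 ≤ 1 / 2 * (v ⬝ᵥ V *ᵥ v) := by positivity
    have h0 := priorDensity_add_smul_rankOne t V n h v 0
    rw [zero_smul, add_zero] at h0
    simp_rw [h0, priorDensity_add_smul_rankOne t V n h v, ← ENNReal.ofReal_mul hb]
    rw [lineDensity_identity hr hb hn]
    congr 1
    refine lintegral_congr fun s => ?_
    by_cases hs : 0 < 1 + s * (v ⬝ᵥ (precision θ)⁻¹ *ᵥ v)
    · rw [secondMoment_add_smul_rankOne h v hs, ← ENNReal.ofReal_mul (lineDensity_nonneg _ _ _ _ _ _),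
        ← ENNReal.ofReal_mul (by positivity)]
      congr 1
      ring
    · simp [lineDensity_of_nonpos (not_lt.1 hs)]
  -- This is why the segment runs backwards from `θ`: outside the cone, subtracting multiples of `v
  -- vᵀ` stays outside, so every term vanishes. Forwards the line could enter the cone.
  · have hz : ∀ s ≤ (0 : ℝ), priorDensity t V n (θ + s • ((0 : ι → ℝ), rankOne v)) = 0 := by
      intro s hs
      refine indicator_of_notMem (fun hmem => h ?_) _
      have := PosDef.add_smul_rankOne hmem v (neg_nonneg.2 hs)
      rwa [add_assoc, ← add_smul, add_neg_cancel, zero_smul, add_zero] at this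
    have h0 := hz 0 le_rfl
    rw [zero_smul, add_zero] at h0
    rw [h0, hz (-1) (by norm_num), setLIntegral_eq_zero measurableSet_Ioc,
      setLIntegral_eq_zero measurableSet_Ioc]
    · exact fun s hs => by simp only [hz s hs.2, zero_mul, mul_zero, Pi.zero_apply]
    · exact fun s hs => by simp only [hz s hs.2, mul_zero, Pi.zero_apply]

instance isAddHaarMeasure_volume_param : (volume : Measure (Param ι)).IsAddHaarMeasure :=
  Measure.prod.instIsAddHaarMeasure (volume : Measure (ι → ℝ)) (volume : Measure (Sym2 ι → ℝ))

/-- The posterior mean of the sufficient statistic `x xᵀ` (Diaconis–Ylvisaker), as a quadratic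
form in `v`. -/
theorem lintegral_priorDensity_mul_secondMoment (t : ι → ℝ) {V : Matrix ι ι ℝ} {n : ℝ} (hn : 0 < n)
    {v : ι → ℝ} (hV : 0 ≤ v ⬝ᵥ V *ᵥ v) (hZ : ∫⁻ θ, priorDensity t V n θ ≠ ∞) :
    ∫⁻ θ, priorDensity t V n θ * ENNReal.ofReal (secondMoment v θ) =
      ENNReal.ofReal (v ⬝ᵥ V *ᵥ v / n) * ∫⁻ θ, priorDensity t V n θ := by
  set S : Param ι := ((0 : ι → ℝ), rankOne v) with hS
  have hF := measurable_priorDensity t V n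
  have hG : Measurable fun θ => priorDensity t V n θ * ENNReal.ofReal (secondMoment v θ) :=
    hF.mul (measurable_secondMoment v).ennreal_ofReal
  -- By Tonelli and translation invariance the inner integral does not depend on `s`, and the
  -- interval has length one.
  have hswap (G : Param ι → ℝ≥0∞) (hG : Measurable G) (c : ℝ≥0∞) :
      ∫⁻ θ, ∫⁻ s in Ioc (-1 : ℝ) 0, c * G (θ + s • S) = c * ∫⁻ θ, G θ := by
    have hm : Measurable fun p : Param ι × ℝ => c * G (p.1 + p.2 • S) := by fun_prop
    rw [lintegral_lintegral_swap hm.aemeasurable]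
    have h (s : ℝ) : ∫⁻ θ, c * G (θ + s • S) = c * ∫⁻ θ, G θ :=
      (lintegral_const_mul c (hG.comp (measurable_add_const (s • S)))).trans
        (congrArg _ (lintegral_add_right_eq_self G _))
    simp_rw [h]
    simp
  have hF' : Measurable fun θ : Param ι => priorDensity t V n (θ + (-1 : ℝ) • S) :=
    hF.comp (measurable_add_const _)
  have key := lintegral_congr (μ := volume) fun θ => priorDensity_line_identity t hn hV θ
  rw [lintegral_add_left hF, lintegral_add_left hF',
    hswap _ hF, hswap _ hG, lintegral_add_right_eq_self (priorDensity t V n)] at key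
  -- The two endpoint terms are now the same total mass, which may be cancelled because it is
  -- finite.
  have key' := (ENNReal.add_right_inj hZ).1 key
  have h2 : ENNReal.ofReal (2 / n) * ENNReal.ofReal (n / 2) = 1 := by
    rw [← ENNReal.ofReal_mul (by positivity)]
    field_simp
    simp
  calc _ = ENNReal.ofReal (2 / n) * (ENNReal.ofReal (n / 2) *
        ∫⁻ θ, priorDensity t V n θ * ENNReal.ofReal (secondMoment v θ)) := by
        rw [← mul_assoc, h2, one_mul]
    _ = _ := by
        rw [← key', ← mul_assoc, ← ENNReal.ofReal_mul (by positivity)]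
        congr 2
        field_simp

end

/-! ### Total mass of the prior: finite and nonzero. -/

section

open Set Filter Topology

theorem integrable_exp_neg_mul_abs {a : ℝ} (ha : 0 < a) :
    Integrable fun x : ℝ => Real.exp (-(a * |x|)) := by
  rw [← integrableOn_univ, ← Iic_union_Ioi (a := (0 : ℝ))]
  refine IntegrableOn.union ?_ ?_
  · refine (integrableOn_exp_mul_Iic ha 0).congr_fun (fun x hx => ?_) measurableSet_Iic
    simp [abs_of_nonpos (show x ≤ 0 from hx)]
  · refine (exp_neg_integrableOn_Ioi 0 ha).congr_fun (fun x hx => ?_) measurableSet_Ioi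
    simp [abs_of_pos (show 0 < x from hx)]

theorem exists_symMatrix_eq {ι : Type*} {Λ : Matrix ι ι ℝ} (hΛ : Λᵀ = Λ) : ∃ u, symMatrix u = Λ :=
  ⟨Sym2.lift ⟨fun i j => Λ i j, fun i j => congrFun (congrFun hΛ j) i⟩, by
    ext i j; simp [symMatrix]⟩

theorem neg_sum_abs_mul_le_form {ι : Type*} [Fintype ι] (Λ : Matrix ι ι ℝ) (x : ι → ℝ) :
    -(∑ i, ∑ j, |Λ i j|) * (x ⬝ᵥ x) ≤ x ⬝ᵥ Λ *ᵥ x := by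
  have hd (k : ι) : x k ^ 2 ≤ x ⬝ᵥ x := by
    rw [sq]
    exact Finset.single_le_sum (f := fun k => x k * x k) (fun l _ => mul_self_nonneg _)
      (Finset.mem_univ k)
  have h1 : -(∑ i, ∑ j, |Λ i j|) * (x ⬝ᵥ x) = ∑ i, ∑ j, -(|Λ i j| * (x ⬝ᵥ x)) := by
    simp [Finset.sum_mul]
  have h2 : x ⬝ᵥ Λ *ᵥ x = ∑ i, ∑ j, x i * (Λ i j * x j) := by
    simp [dotProduct, Matrix.mulVec, Finset.mul_sum]
  rw [h1, h2]
  refine Finset.sum_le_sum fun i _ => Finset.sum_le_sum fun j _ => ?_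
  have h3 : |x i * x j| ≤ x ⬝ᵥ x := by
    rw [abs_le]
    constructor <;> nlinarith [sq_nonneg (x i + x j), sq_nonneg (x i - x j), hd i, hd j]
  refine le_trans ?_ (neg_abs_le _)
  rw [show x i * (Λ i j * x j) = Λ i j * (x i * x j) by ring, abs_mul]
  exact neg_le_neg (mul_le_mul_of_nonneg_left h3 (abs_nonneg _))

variable {ι : Type*} [Fintype ι] [DecidableEq ι]

theorem PosSemidef.exists_eq_mul_self {Λ : Matrix ι ι ℝ} (hΛ : Λ.PosSemidef) :
    ∃ S : Matrix ι ι ℝ, Sᵀ = S ∧ S * S = Λ := by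
  open scoped MatrixOrder in
  have hSp : (CFC.sqrt Λ).PosSemidef := Matrix.nonneg_iff_posSemidef.1 (CFC.sqrt_nonneg Λ)
  exact ⟨CFC.sqrt Λ, by simpa using hSp.isHermitian.eq, CFC.sqrt_mul_sqrt_self _ hΛ.nonneg⟩

/-- With `Λ = S S` and `S` symmetric, this is Cauchy–Schwarz applied to each row of `S`. -/
theorem PosSemidef.form_le_trace {Λ : Matrix ι ι ℝ} (hΛ : Λ.PosSemidef) (t : ι → ℝ) :
    t ⬝ᵥ Λ *ᵥ t ≤ (t ⬝ᵥ t) * Λ.trace := by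
  obtain ⟨S, hST, rfl⟩ := PosSemidef.exists_eq_mul_self hΛ
  have h1 : t ⬝ᵥ (S * S) *ᵥ t = ∑ k, (∑ j, S k j * t j) ^ 2 := by
    rw [← Matrix.mulVec_mulVec, Matrix.dotProduct_mulVec, ← Matrix.mulVec_transpose, hST]
    simp [dotProduct, Matrix.mulVec, sq]
  have h2 : (S * S).trace = ∑ k, ∑ j, S k j ^ 2 := by
    simp only [Matrix.trace, Matrix.diag_apply, Matrix.mul_apply]
    refine Finset.sum_congr rfl fun k _ => Finset.sum_congr rfl fun j _ => ?_
    rw [sq]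
    congr 1
    exact congrFun (congrFun hST k) j
  rw [h1, h2, Finset.mul_sum]
  refine Finset.sum_le_sum fun k _ => (Finset.sum_mul_sq_le_sq_mul_sq _ _ _).trans ?_
  rw [mul_comm]
  simp [dotProduct, sq]

theorem PosSemidef.abs_apply_le_trace {Λ : Matrix ι ι ℝ} (hΛ : Λ.PosSemidef) (i j : ι) :
    |Λ i j| ≤ Λ.trace := by
  have hd : ∀ k, Λ k k ≤ Λ.trace := fun k =>
    Finset.single_le_sum (f := fun k => Λ k k) (fun l _ => hΛ.diag_nonneg) (Finset.mem_univ k)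
  have hij : |Λ i j| ≤ (Λ i i + Λ j j) / 2 := by
    obtain ⟨S, hST, rfl⟩ := PosSemidef.exists_eq_mul_self hΛ
    have hs (k l : ι) : S l k = S k l := congrFun (congrFun hST k) l
    simp only [Matrix.mul_apply, hs _ i]
    rw [← Finset.sum_add_distrib, Finset.sum_div]
    refine (Finset.abs_sum_le_sum_abs _ _).trans (Finset.sum_le_sum fun k _ => ?_)
    rw [hs j k, hs i k, abs_le]
    constructor <;> nlinarith [sq_nonneg (S i k + S j k), sq_nonneg (S i k - S j k)]
  linarith [hd i, hd j]

/-- Sum over the eigenvalues of `log (ε l) ≤ ε l - 1`. The free `ε` lets the determinant cost an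
arbitrarily small part of the trace. -/
theorem PosDef.log_det_le {Λ : Matrix ι ι ℝ} (hΛ : Λ.PosDef) {ε : ℝ} (hε : 0 < ε) :
    Real.log Λ.det ≤ ε * Λ.trace - Fintype.card ι * (1 + Real.log ε) := by
  rw [hΛ.isHermitian.det_eq_prod_eigenvalues, hΛ.isHermitian.trace_eq_sum_eigenvalues]
  simp only [RCLike.ofReal_real_eq_id, id_eq]
  rw [Real.log_prod fun i _ => (hΛ.eigenvalues_pos i).ne', Finset.mul_sum]
  have h : ∀ i, Real.log (hΛ.isHermitian.eigenvalues i) ≤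
      ε * hΛ.isHermitian.eigenvalues i - (1 + Real.log ε) := fun i => by
    have h1 := hΛ.eigenvalues_pos i
    have h2 := Real.log_le_sub_one_of_pos (mul_pos hε h1)
    rw [Real.log_mul hε.ne' h1.ne'] at h2
    linarith
  refine (Finset.sum_le_sum fun i _ => h i).trans_eq ?_
  rw [Finset.sum_sub_distrib, Finset.sum_const, Finset.card_univ, nsmul_eq_mul]

/-- The likelihood has mass one, so its density supplies the Gaussian integral. -/
theorem lintegral_exp_canonical {θ : Param ι} (hθ : (precision θ).PosDef) :
    ∫⁻ x : ι → ℝ, ENNReal.ofReal (Real.exp (θ.1 ⬝ᵥ x - (1 / 2) * (x ⬝ᵥ precision θ *ᵥ x))) =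
      ENNReal.ofReal (Real.exp (logPartition θ)) := by
  have h1 : likelihood θ univ = 1 := measure_univ
  rw [likelihood_eq_withDensity hθ, withDensity_apply _ MeasurableSet.univ, Measure.restrict_univ,
    ← (PiLp.volume_preserving_toLp ι).lintegral_comp_emb
      (MeasurableEquiv.toLp 2 (ι → ℝ)).measurableEmbedding] at h1
  have h2 (x : ι → ℝ) : ENNReal.ofReal (Real.exp (θ.1 ⬝ᵥ x - (1 / 2) * (x ⬝ᵥ precision θ *ᵥ x))) =
      ENNReal.ofReal (Real.exp (logPartition θ)) * ENNReal.ofReal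
        (Real.exp (θ.1 ⬝ᵥ x - (1 / 2) * (x ⬝ᵥ precision θ *ᵥ x) - logPartition θ)) := by
    rw [← ENNReal.ofReal_mul (Real.exp_pos _).le, ← Real.exp_add]
    congr 2
    ring
  simp_rw [h2]
  rw [lintegral_const_mul, h1, mul_one]
  simp only [dotProduct, Matrix.mulVec]
  fun_prop

/-- For fixed `Λ` the density in `η` is itself a canonical Gaussian exponent, with linear term `t`
and precision `n Λ⁻¹`; its log-partition function evaluates the integral. -/
theorem lintegral_priorDensity_fst (t : ι → ℝ) (v₀ : ℝ) {n : ℝ} (hn : 0 < n) {u : Sym2 ι → ℝ}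
    (hu : (symMatrix u).PosDef) :
    ∫⁻ η : ι → ℝ, priorDensity t (v₀ • 1) n (η, u) = ENNReal.ofReal (Real.exp
      (1 / (2 * n) * (t ⬝ᵥ symMatrix u *ᵥ t) + (n + 1) / 2 * Real.log (symMatrix u).det
        - 1 / 2 * v₀ * (symMatrix u).trace
        - Fintype.card ι / 2 * (Real.log n + (n - 1) * Real.log (2 * Real.pi)))) := by
  set Λ := symMatrix u with hΛ
  have hP (η : ι → ℝ) : precision (η, u) = Λ := rfl
  obtain ⟨w, hw⟩ := exists_symMatrix_eq (Λ := n • Λ⁻¹) (by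
    have := (hu.inv.smul hn).isHermitian.eq
    simpa only [Matrix.conjTranspose_eq_transpose_of_trivial] using this)
  have hPw : precision (t, w) = n • Λ⁻¹ := hw
  have hPd : (precision (t, w)).PosDef := hPw ▸ hu.inv.smul hn
  have hdet : 0 < Λ.det := hu.det_pos
  have hinv : (n • Λ⁻¹)⁻¹ = n⁻¹ • Λ := by
    refine Matrix.inv_eq_right_inv ?_
    rw [Matrix.smul_mul, Matrix.mul_smul, Matrix.nonsing_inv_mul _ hdet.ne'.isUnit, smul_smul,
      mul_inv_cancel₀ hn.ne', one_smul]
  have hA : logPartition (t, w) = 1 / (2 * n) * (t ⬝ᵥ Λ *ᵥ t)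
      - 1 / 2 * (Fintype.card ι * Real.log n - Real.log Λ.det)
      + Fintype.card ι / 2 * Real.log (2 * Real.pi) := by
    rw [logPartition, hPw, hinv, Matrix.det_smul, Matrix.det_nonsing_inv, Ring.inverse_eq_inv',
      Real.log_mul (by positivity) (by positivity), Real.log_pow, Real.log_inv, Matrix.smul_mulVec,
      dotProduct_smul, smul_eq_mul]
    field_simp
    ring
  have key := lintegral_exp_canonical hPd
  have h (η : ι → ℝ) : priorDensity t (v₀ • 1) n (η, u) = ENNReal.ofReal (Real.exp
      (n / 2 * Real.log Λ.det - 1 / 2 * v₀ * Λ.trace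
        - n * (Fintype.card ι / 2) * Real.log (2 * Real.pi))) *
      ENNReal.ofReal (Real.exp (t ⬝ᵥ η - (1 / 2) * (η ⬝ᵥ precision (t, w) *ᵥ η))) := by
    rw [priorDensity, indicator_of_mem (show _ ∈ {θ : Param ι | (precision θ).PosDef} from hu),
      ← ENNReal.ofReal_mul (Real.exp_pos _).le, ← Real.exp_add, hPw, Matrix.smul_mulVec,
      dotProduct_smul, logPartition, hP, Matrix.transpose_smul, Matrix.transpose_one,
      Matrix.smul_mul, Matrix.trace_smul, Matrix.one_mul]
    congr 2
    simp only [smul_eq_mul]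
    ring
  simp_rw [h]
  rw [lintegral_const_mul, key, hA, ← ENNReal.ofReal_mul (Real.exp_pos _).le, ← Real.exp_add]
  · congr 2
    ring
  · simp only [dotProduct, Matrix.mulVec]
    fun_prop

theorem lintegral_priorDensity_ne_top (t : ι → ℝ) {v₀ n : ℝ} (hn : 0 < n)
    (ht : t ⬝ᵥ t < n * v₀) : ∫⁻ θ, priorDensity t (v₀ • 1) n θ ≠ ∞ := by
  -- The linear terms in the exponent total at most `-2 c tr Λ`. One `c tr Λ` is spent on the
  -- log-determinant, which fixes `ε`, and the other gives decay in the entries, each at most `tr Λ`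
  -- in absolute value. The `+ 1` in `N` keeps it positive when there are no entries.
  set c : ℝ := (v₀ - (t ⬝ᵥ t) / n) / 4 with hc
  have hcpos : 0 < c := by
    have : (t ⬝ᵥ t) / n < v₀ := by rw [div_lt_iff₀ hn]; linarith
    simp only [hc]; linarith
  set N : ℝ := Fintype.card (Sym2 ι) + 1 with hN
  have hNpos : 0 < N := by positivity
  set ε : ℝ := 2 * c / (n + 1) with hε
  have hεpos : 0 < ε := by positivity
  set K : ℝ := -((n + 1) / 2 * (Fintype.card ι * (1 + Real.log ε)))
    - Fintype.card ι / 2 * (Real.log n + (n - 1) * Real.log (2 * Real.pi)) with hK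
  have hbound (u : Sym2 ι → ℝ) : ∫⁻ η : ι → ℝ, priorDensity t (v₀ • 1) n (η, u) ≤
      ENNReal.ofReal (Real.exp K) * ∏ e, ENNReal.ofReal (Real.exp (-(c / N * |u e|))) := by
    by_cases hu : (symMatrix u).PosDef
    · rw [lintegral_priorDensity_fst t v₀ hn hu,
        ← ENNReal.ofReal_prod_of_nonneg fun _ _ => (Real.exp_pos _).le, ← Real.exp_sum,
        ← ENNReal.ofReal_mul (Real.exp_pos _).le, ← Real.exp_add]
      refine ENNReal.ofReal_le_ofReal (Real.exp_le_exp.2 ?_)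
      have h1 := PosSemidef.form_le_trace hu.posSemidef t
      have h2 := PosDef.log_det_le hu hεpos
      have h3 : ∑ e, |u e| ≤ N * (symMatrix u).trace := by
        have : ∀ e ∈ Finset.univ, |u e| ≤ (symMatrix u).trace := fun e _ => by
          induction e with
          | _ i j => exact PosSemidef.abs_apply_le_trace hu.posSemidef i j
        refine (Finset.sum_le_card_nsmul _ _ _ this).trans ?_
        rw [nsmul_eq_mul, hN, Finset.card_univ]
        linarith [hu.posSemidef.trace_nonneg]
      rw [Finset.sum_neg_distrib, ← Finset.mul_sum]
      have h4 : c / N * ∑ e, |u e| ≤ c * (symMatrix u).trace := by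
        refine (mul_le_mul_of_nonneg_left h3 (by positivity)).trans_eq ?_
        field_simp
      have h5 : 1 / (2 * n) * (t ⬝ᵥ symMatrix u *ᵥ t) ≤
          1 / 2 * (t ⬝ᵥ t / n) * (symMatrix u).trace := by
        refine (mul_le_mul_of_nonneg_left h1 (by positivity)).trans_eq ?_
        field_simp
      have h6 : (n + 1) / 2 * Real.log (symMatrix u).det ≤
          c * (symMatrix u).trace - (n + 1) / 2 * (Fintype.card ι * (1 + Real.log ε)) := by
        refine (mul_le_mul_of_nonneg_left h2 (by positivity)).trans_eq ?_
        rw [mul_sub, hε]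
        field_simp
      have h7 : 1 / 2 * v₀ * (symMatrix u).trace = 2 * c * (symMatrix u).trace +
          1 / 2 * (t ⬝ᵥ t / n) * (symMatrix u).trace := by
        rw [hc]; ring
      linarith
    · have h0 (η : ι → ℝ) : priorDensity t (v₀ • 1) n (η, u) = 0 :=
        indicator_of_notMem (show _ ∉ {θ : Param ι | (precision θ).PosDef} from hu) _
      simp [h0]
  have hprod : ∫⁻ θ, priorDensity t (v₀ • 1) n θ =
      ∫⁻ u : Sym2 ι → ℝ, ∫⁻ η : ι → ℝ, priorDensity t (v₀ • 1) n (η, u) :=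
    lintegral_prod_symm' _ (measurable_priorDensity t _ n)
  rw [hprod]
  refine ne_top_of_le_ne_top ?_ (lintegral_mono hbound)
  rw [lintegral_const_mul _ (by fun_prop), volume_pi, lintegral_fintype_prod_eq_prod
    (fun (_ : Sym2 ι) (x : ℝ) => ENNReal.ofReal (Real.exp (-(c / N * |x|)))) (by fun_prop)]
  refine ENNReal.mul_ne_top ENNReal.ofReal_ne_top (ENNReal.prod_ne_top fun e _ => ?_)
  rw [← ofReal_integral_eq_lintegral_ofReal (integrable_exp_neg_mul_abs (by positivity))
    (Eventually.of_forall fun x => (Real.exp_pos _).le)]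
  exact ENNReal.ofReal_ne_top

/-- Every symmetric matrix becomes positive definite after adding a large multiple of the identity,
so countably many translates of the cone cover the space. -/
theorem volume_posDef_ne_zero : volume {θ : Param ι | (precision θ).PosDef} ≠ 0 := by
  intro h0
  obtain ⟨e, he⟩ := exists_symMatrix_eq (Matrix.transpose_one (n := ι) (α := ℝ))
  set E : Param ι := (0, e) with hE
  have hcover : (univ : Set (Param ι)) ⊆
      ⋃ k : ℕ, (fun θ => θ + (k : ℝ) • E) ⁻¹' {θ : Param ι | (precision θ).PosDef} := by
    intro θ _
    obtain ⟨k, hk⟩ := exists_nat_gt (∑ i, ∑ j, |precision θ i j|)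
    refine mem_iUnion.2 ⟨k, (posDef_precision_iff _).2 fun x hx => ?_⟩
    have h1 : precision (θ + (k : ℝ) • E) = precision θ + (k : ℝ) • 1 := by
      rw [← he]; ext i j; simp [precision, symMatrix, hE]
    have h2 := neg_sum_abs_mul_le_form (precision θ) x
    have h3 : 0 < x ⬝ᵥ x := by
      simpa using Matrix.dotProduct_star_self_pos_iff.2 hx
    rw [h1, Matrix.add_mulVec, dotProduct_add, Matrix.smul_mulVec, Matrix.one_mulVec,
      dotProduct_smul, smul_eq_mul]
    nlinarith
  have : volume (univ : Set (Param ι)) = 0 := by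
    refine measure_mono_null hcover (measure_iUnion_null fun k => ?_)
    rw [measure_preimage_add_right, h0]
  exact (NeZero.ne (volume : Measure (Param ι))) (Measure.measure_univ_eq_zero.1 this)

theorem lintegral_priorDensity_ne_zero (t : ι → ℝ) (V : Matrix ι ι ℝ) (n : ℝ) :
    ∫⁻ θ, priorDensity t V n θ ≠ 0 := by
  intro h
  rw [lintegral_eq_zero_iff (measurable_priorDensity t V n)] at h
  refine volume_posDef_ne_zero (ι := ι) (measure_mono_null (fun θ hθ => ?_) h)
  simp only [mem_compl_iff, mem_ofPred_eq, priorDensity, indicator_of_mem hθ, Pi.zero_apply,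
    ENNReal.ofReal_eq_zero, not_le]
  exact Real.exp_pos _

end

/-! ### Conjugacy and the posterior. -/

section

open Set Filter Topology

variable {ι : Type*} [Fintype ι] [DecidableEq ι]

theorem unnormalizedPrior_eq_withDensity (t : ι → ℝ) (V : Matrix ι ι ℝ) (n : ℝ) :
    unnormalizedPrior t V n = volume.withDensity (priorDensity t V n) :=
  (withDensity_indicator measurableSet_posDef _).symm

theorem unnormalizedPrior_univ (t : ι → ℝ) (V : Matrix ι ι ℝ) (n : ℝ) :
    unnormalizedPrior t V n univ = ∫⁻ θ, priorDensity t V n θ := by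
  rw [unnormalizedPrior_eq_withDensity, withDensity_apply _ MeasurableSet.univ,
    Measure.restrict_univ]

theorem priorDensity_lt_top (t : ι → ℝ) (V : Matrix ι ι ℝ) (n : ℝ) (θ : Param ι) :
    priorDensity t V n θ < ∞ := by
  by_cases h : (precision θ).PosDef
  · simp [priorDensity, h]
  · rw [priorDensity, indicator_of_notMem (show _ ∉ {θ : Param ι | (precision θ).PosDef} from h)]
    simp

/-- Finiteness of the density everywhere allows an arbitrary `f`, so measurability in `θ` of the
expected loss need not be established here. -/
theorem lintegral_prior (t : ι → ℝ) (V : Matrix ι ι ℝ) (n : ℝ) (f : Param ι → ℝ≥0∞) :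
    ∫⁻ θ, f θ ∂(prior t V n) =
      (∫⁻ θ, priorDensity t V n θ)⁻¹ * ∫⁻ θ, priorDensity t V n θ * f θ := by
  rw [prior, lintegral_smul_measure, unnormalizedPrior_univ, unnormalizedPrior_eq_withDensity,
    lintegral_withDensity_eq_lintegral_mul_non_measurable _ (measurable_priorDensity t V n)
      (Eventually.of_forall (priorDensity_lt_top t V n)), smul_eq_mul]
  rfl

/-- The parameter `t` of the posterior. -/
def postMean {M : ℕ} (t : ι → ℝ) (D : Fin M → EuclideanSpace ℝ ι) : ι → ℝ :=
  t + ∑ m, (D m).ofLp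

/-- The parameter `V` of the posterior. -/
def postScale {M : ℕ} (V : Matrix ι ι ℝ) (D : Fin M → EuclideanSpace ℝ ι) : Matrix ι ι ℝ :=
  V + ∑ m, Matrix.vecMulVec (D m).ofLp (D m).ofLp

/-- The Lebesgue density of the posterior times the marginal density of the data. -/
def postDensity {M : ℕ} (t : ι → ℝ) (V : Matrix ι ι ℝ) (n : ℝ)
    (D : Fin M → EuclideanSpace ℝ ι) : Param ι → ℝ≥0∞ :=
  priorDensity (postMean t D) (postScale V D) (n + M)

theorem measurable_postDensity {M : ℕ} (t : ι → ℝ) (V : Matrix ι ι ℝ) (n : ℝ) :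
    Measurable fun p : (Fin M → EuclideanSpace ℝ ι) × Param ι => postDensity t V n p.1 p.2 := by
  refine measurable_priorDensity_comp (α := (Fin M → EuclideanSpace ℝ ι) × Param ι) _ ?_ ?_
    measurable_snd
  · unfold postMean
    fun_prop
  · intro i j
    simp only [postScale, Matrix.add_apply, Matrix.sum_apply, Matrix.vecMulVec_apply]
    fun_prop

/-- The Lebesgue density of the likelihood. -/
def likelihoodDensity (θ : Param ι) (x : EuclideanSpace ℝ ι) : ℝ≥0∞ :=
  ENNReal.ofReal (Real.exp
    (θ.1 ⬝ᵥ x.ofLp - (1 / 2) * (x.ofLp ⬝ᵥ precision θ *ᵥ x.ofLp) - logPartition θ))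

theorem measurable_likelihoodDensity (θ : Param ι) : Measurable (likelihoodDensity θ) := by
  unfold likelihoodDensity
  simp only [dotProduct, Matrix.mulVec]
  fun_prop

theorem pi_likelihood_eq_withDensity {M : ℕ} {θ : Param ι} (hθ : (precision θ).PosDef) :
    Measure.pi (fun _ : Fin M => likelihood θ) =
      volume.withDensity fun D => ∏ m, likelihoodDensity θ (D m) := by
  have h : likelihood θ = volume.withDensity (likelihoodDensity θ) := likelihood_eq_withDensity hθ
  have : SigmaFinite (volume.withDensity (likelihoodDensity θ)) := h ▸ inferInstance
  rw [h, pi_withDensity _ fun _ => measurable_likelihoodDensity θ]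
  rfl

/-- Conjugacy: prior density times likelihood. -/
theorem priorDensity_mul_prod_likelihoodDensity {M : ℕ} (t : ι → ℝ) (V : Matrix ι ι ℝ) (n : ℝ)
    (D : Fin M → EuclideanSpace ℝ ι) (θ : Param ι) :
    priorDensity t V n θ * ∏ m, likelihoodDensity θ (D m) = postDensity t V n D θ := by
  by_cases h : θ ∈ {θ : Param ι | (precision θ).PosDef}
  · rw [postDensity, priorDensity, priorDensity, indicator_of_mem h, indicator_of_mem h]
    unfold likelihoodDensity
    rw [← ENNReal.ofReal_prod_of_nonneg fun _ _ => (Real.exp_pos _).le, ← Real.exp_sum,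
      ← ENNReal.ofReal_mul (Real.exp_pos _).le, ← Real.exp_add]
    congr 2
    have htr (x : ι → ℝ) : ((Matrix.vecMulVec x x)ᵀ * precision θ).trace =
        x ⬝ᵥ precision θ *ᵥ x := by
      rw [Matrix.trace_mul_comm, Matrix.transpose_vecMulVec, Matrix.mul_vecMulVec,
        Matrix.trace_vecMulVec, dotProduct_comm]
    rw [postMean, postScale, Matrix.transpose_add, Matrix.transpose_sum, add_mul, Finset.sum_mul,
      Matrix.trace_add, Matrix.trace_sum, add_dotProduct, sum_dotProduct]
    simp only [htr, Finset.sum_sub_distrib, ← Finset.mul_sum, Finset.sum_const, Finset.card_univ,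
      Fintype.card_fin, nsmul_eq_mul, dotProduct_comm θ.1]
    ring
  · rw [postDensity, priorDensity, priorDensity, indicator_of_notMem h, indicator_of_notMem h,
      zero_mul]

/-- Bayes' formula: Tonelli for the joint density of data and parameter, combined with conjugacy. -/
theorem lintegral_priorDensity_mul_lintegral_pi {M : ℕ} (t : ι → ℝ) (V : Matrix ι ι ℝ) (n : ℝ)
    {g : (Fin M → EuclideanSpace ℝ ι) → Param ι → ℝ≥0∞} (hg : Measurable (Function.uncurry g)) :
    ∫⁻ θ, priorDensity t V n θ * ∫⁻ D, g D θ ∂(Measure.pi fun _ : Fin M => likelihood θ) =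
      ∫⁻ D, ∫⁻ θ, postDensity t V n D θ * g D θ := by
  rw [lintegral_lintegral_swap
    ((measurable_postDensity t V n).mul hg).aemeasurable]
  refine lintegral_congr fun θ => ?_
  by_cases h : (precision θ).PosDef
  · have hm : Measurable fun D : Fin M → EuclideanSpace ℝ ι => ∏ m, likelihoodDensity θ (D m) :=
      Finset.measurable_prod _ fun m _ =>
        (measurable_likelihoodDensity θ).comp (measurable_pi_apply m)
    have hgθ : Measurable fun D => g D θ := hg.comp measurable_prodMk_right
    rw [pi_likelihood_eq_withDensity h, lintegral_withDensity_eq_lintegral_mul _ hm hgθ,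
      ← lintegral_const_mul _ (hm.mul hgθ)]
    refine lintegral_congr fun D => ?_
    rw [← priorDensity_mul_prod_likelihoodDensity, Pi.mul_apply, mul_assoc]
  · have h0 (t : ι → ℝ) (V : Matrix ι ι ℝ) (n : ℝ) : priorDensity t V n θ = 0 :=
      indicator_of_notMem (show _ ∉ {θ : Param ι | (precision θ).PosDef} from h) _
    simp [postDensity, h0]

/-- The marginal density of the data integrates to the mass of the prior. This gives almost every
posterior finite mass without a normalisability criterion for a general scale matrix. -/
theorem ae_lintegral_postDensity_lt_top {M : ℕ} {t : ι → ℝ} {V : Matrix ι ι ℝ} {n : ℝ}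
    (hZ : ∫⁻ θ, priorDensity t V n θ ≠ ∞) :
    ∀ᵐ D : Fin M → EuclideanSpace ℝ ι, ∫⁻ θ, postDensity t V n D θ < ∞ := by
  refine ae_lt_top (measurable_postDensity t V n).lintegral_prod_right' ?_
  have h := lintegral_priorDensity_mul_lintegral_pi (M := M) t V n (g := fun _ _ => 1)
    measurable_const
  simp only [lintegral_one, measure_univ, mul_one] at h
  rwa [← h]

theorem form_postScale {M : ℕ} (v₀ : ℝ) (D : Fin M → EuclideanSpace ℝ ι) (v : ι → ℝ) :
    v ⬝ᵥ postScale (v₀ • 1) D *ᵥ v = v₀ * (v ⬝ᵥ v) + ∑ m, (v ⬝ᵥ (D m).ofLp) ^ 2 := by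
  rw [postScale, Matrix.add_mulVec, Matrix.sum_mulVec, Matrix.smul_mulVec, Matrix.one_mulVec,
    dotProduct_add, dotProduct_sum, dotProduct_smul, smul_eq_mul]
  simp only [dotProduct_vecMulVec_mulVec, dotProduct_comm _ v]

end

/-! ### The regret as an integral of posterior losses. -/

section

open Set Filter Topology

variable {d L M : ℕ}

/-- The vector `v` with `v ⬝ᵥ [vec(C), h] = (h + C a) i`. -/
def residualVec (a : Fin L → ℝ) (i : Fin d) : Idx d L → ℝ :=
  Sum.elim (fun p => if p.2 = i then a p.1 else 0) (Pi.single i 1)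

theorem residualVec_dotProduct (a : Fin L → ℝ) (i : Fin d) (x : Obs d L) :
    residualVec a i ⬝ᵥ x.ofLp = (grad x + ctrl x *ᵥ a) i := by
  simp only [residualVec, dotProduct, Fintype.sum_sum_type, Fintype.sum_prod_type, Sum.elim_inl,
    Sum.elim_inr, ite_mul, zero_mul, Finset.sum_ite_eq', Finset.mem_univ, if_true, Pi.add_apply,
    Matrix.mulVec, grad, ctrl, Matrix.of_apply]
  rw [Finset.sum_eq_single i (fun j _ hj => by simp [hj]) (by simp), Pi.single_eq_same, one_mul,
    add_comm]
  simp only [mul_comm]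

/-- Source of the ridge penalty: the prior scale `v₀ I` contributes `v₀ (‖a‖² + 1)` for each of the
`d` coordinates. -/
theorem residualVec_dotProduct_self (a : Fin L → ℝ) (i : Fin d) :
    residualVec a i ⬝ᵥ residualVec a i = a ⬝ᵥ a + 1 := by
  simp [residualVec, dotProduct, Fintype.sum_sum_type, Fintype.sum_prod_type, Pi.single_apply]

theorem measurable_residualVec (i : Fin d) :
    Measurable fun a : Fin L → ℝ => residualVec a i := by
  refine measurable_pi_iff.2 fun p => ?_
  rcases p with p | p
  · simp only [residualVec, Sum.elim_inl]
    by_cases h : p.2 = i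
    · simp only [h, if_true]; fun_prop
    · simp only [h, if_false]; fun_prop
  · exact measurable_const

theorem loss_eq_sum_secondMoment (a : Fin L → ℝ) {θ : Param (Idx d L)}
    (hθ : (precision θ).PosDef) :
    loss a θ = ∑ i : Fin d, ENNReal.ofReal (secondMoment (residualVec a i) θ) := by
  have h (x : Obs d L) : ENNReal.ofReal (‖WithLp.toLp 2 (grad x + ctrl x *ᵥ a)‖ ^ 2) =
      ∑ i : Fin d, ENNReal.ofReal ((residualVec a i ⬝ᵥ x.ofLp) ^ 2) := by
    rw [EuclideanSpace.real_norm_sq_eq, ENNReal.ofReal_sum_of_nonneg fun i _ => sq_nonneg _]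
    simp only [residualVec_dotProduct]
  simp only [loss, h]
  rw [lintegral_finsetSum]
  · exact Finset.sum_congr rfl fun i _ => lintegral_sq_likelihood hθ _
  · intro i _
    simp only [dotProduct]
    fun_prop

/-- `n₀ + M` times the posterior expected loss of the action `a`. -/
def postLoss (v₀ : ℝ) (D : Fin M → Obs d L) (a : Fin L → ℝ) : ℝ :=
  d * v₀ * (a ⬝ᵥ a + 1) +
    ∑ m, (grad (D m) + ctrl (D m) *ᵥ a) ⬝ᵥ (grad (D m) + ctrl (D m) *ᵥ a)

theorem sum_form_postScale (v₀ : ℝ) (D : Fin M → Obs d L) (a : Fin L → ℝ) :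
    ∑ i : Fin d, residualVec a i ⬝ᵥ postScale (v₀ • 1) D *ᵥ residualVec a i = postLoss v₀ D a := by
  simp only [form_postScale, residualVec_dotProduct_self, residualVec_dotProduct, postLoss,
    Finset.sum_add_distrib, Finset.sum_const, Finset.card_univ, Fintype.card_fin, nsmul_eq_mul]
  rw [Finset.sum_comm]
  simp only [dotProduct, sq, mul_assoc]

theorem lintegral_priorDensity_mul_loss (t : Idx d L → ℝ) {V : Matrix (Idx d L) (Idx d L) ℝ} {n : ℝ}
    (hn : 0 < n) (a : Fin L → ℝ) (hV : ∀ i, 0 ≤ residualVec a i ⬝ᵥ V *ᵥ residualVec a i)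
    (hZ : ∫⁻ θ, priorDensity t V n θ ≠ ∞) :
    ∫⁻ θ, priorDensity t V n θ * ∑ i : Fin d, ENNReal.ofReal (secondMoment (residualVec a i) θ) =
      ENNReal.ofReal ((∑ i, residualVec a i ⬝ᵥ V *ᵥ residualVec a i) / n) *
        ∫⁻ θ, priorDensity t V n θ := by
  simp only [Finset.mul_sum]
  have hm (i : Fin d) : Measurable fun θ => priorDensity t V n θ *
      ENNReal.ofReal (secondMoment (residualVec a i) θ) :=
    (measurable_priorDensity t V n).mul (measurable_secondMoment _).ennreal_ofReal
  rw [lintegral_finsetSum _ fun i _ => hm i, Finset.sum_div,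
    ENNReal.ofReal_sum_of_nonneg fun i _ => div_nonneg (hV i) hn.le, Finset.sum_mul]
  exact Finset.sum_congr rfl fun i _ => lintegral_priorDensity_mul_secondMoment t hn (hV i) hZ

variable {t₀ : Idx d L → ℝ} {n₀ v₀ : ℝ}

theorem bayesRegret_eq (hn₀ : 0 < n₀) (hv₀ : 0 ≤ v₀)
    (hZ : ∫⁻ θ, priorDensity t₀ (v₀ • 1) n₀ θ ≠ ∞) {δ : Rule d L M} (hδ : Measurable δ) :
    bayesRegret (prior t₀ (v₀ • 1) n₀) δ = (∫⁻ θ, priorDensity t₀ (v₀ • 1) n₀ θ)⁻¹ *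
      ∫⁻ D, ENNReal.ofReal (postLoss v₀ D (δ D) / (n₀ + M)) *
        ∫⁻ θ, postDensity t₀ (v₀ • 1) n₀ D θ := by
  rw [bayesRegret, lintegral_prior]
  congr 1
  -- The closed form of the loss holds only on the cone, but the prior density is zero elsewhere.
  -- Unlike `loss`, the closed form is visibly jointly measurable, as Tonelli requires.
  have h1 : ∀ θ : Param (Idx d L), priorDensity t₀ (v₀ • 1) n₀ θ *
        ∫⁻ D, loss (δ D) θ ∂(Measure.pi fun _ : Fin M => likelihood θ) =
      priorDensity t₀ (v₀ • 1) n₀ θ * ∫⁻ D, ∑ i : Fin d, ENNReal.ofReal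
        (secondMoment (residualVec (δ D) i) θ) ∂(Measure.pi fun _ : Fin M => likelihood θ) := by
    intro θ
    by_cases h : θ ∈ {θ : Param (Idx d L) | (precision θ).PosDef}
    · simp only [loss_eq_sum_secondMoment _ h]
    · rw [priorDensity, indicator_of_notMem h, zero_mul, zero_mul]
  have hg : Measurable (Function.uncurry fun (D : Fin M → Obs d L) (θ : Param (Idx d L)) =>
      ∑ i : Fin d, ENNReal.ofReal (secondMoment (residualVec (δ D) i) θ)) :=
    Finset.measurable_sum _ fun i _ => (measurable_secondMoment_comp
      ((measurable_residualVec i).comp (hδ.comp measurable_fst)) measurable_snd).ennreal_ofReal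
  rw [lintegral_congr h1, lintegral_priorDensity_mul_lintegral_pi _ _ _ hg]
  refine lintegral_congr_ae ?_
  filter_upwards [ae_lintegral_postDensity_lt_top (M := M) hZ] with D hD
  rw [← sum_form_postScale]
  refine lintegral_priorDensity_mul_loss _ (by positivity) _ (fun i => ?_) hD.ne
  rw [form_postScale, residualVec_dotProduct_self]
  have : 0 ≤ δ D ⬝ᵥ δ D := Finset.sum_nonneg fun _ _ => mul_self_nonneg _
  positivity

end

/-! ### The ridge rule as the unique minimiser of the posterior loss. -/

section

open Set Filter Topology

variable {d L M : ℕ}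

theorem continuous_ctrl_apply (m : Fin M) (i : Fin d) (l : Fin L) :
    Continuous fun D : Fin M → Obs d L => ctrl (D m) i l := by
  simp only [ctrl, Matrix.of_apply]
  fun_prop

theorem continuous_grad_apply (m : Fin M) (i : Fin d) :
    Continuous fun D : Fin M → Obs d L => grad (D m) i := by
  simp only [grad]
  fun_prop

theorem continuous_ridgeMatrix (v₀ : ℝ) :
    Continuous (ridgeMatrix v₀ : (Fin M → Obs d L) → Matrix (Fin L) (Fin L) ℝ) := by
  have := continuous_ctrl_apply (d := d) (L := L) (M := M)
  refine continuous_matrix fun k l => ?_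
  simp only [ridgeMatrix, meanCC, Matrix.add_apply, Matrix.smul_apply, Matrix.sum_apply,
    Matrix.mul_apply, Matrix.transpose_apply]
  fun_prop

theorem measurable_ridgeRule (v₀ : ℝ) : Measurable (ridgeRule v₀ : Rule d L M) := by
  have h1 := continuous_ctrl_apply (d := d) (L := L) (M := M)
  have h2 := continuous_grad_apply (d := d) (L := L) (M := M)
  refine measurable_pi_iff.2 fun k => ?_
  simp only [ridgeRule, Pi.neg_apply, Matrix.mulVec, dotProduct]
  refine (Finset.measurable_sum _ fun l _ => Measurable.mul ?_ ?_).neg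
  · simp only [Matrix.inv_def, Matrix.smul_apply, smul_eq_mul, Ring.inverse_eq_inv']
    exact (continuous_ridgeMatrix v₀).matrix_det.measurable.inv.mul
      ((continuous_ridgeMatrix v₀).matrix_adjugate.matrix_elem k l).measurable
  · refine Continuous.measurable ?_
    simp only [meanCh, Pi.smul_apply, Finset.sum_apply, Matrix.mulVec, dotProduct,
      Matrix.transpose_apply]
    fun_prop

theorem posDef_ridgeMatrix (hd : 0 < d) (hM : 0 < M) {v₀ : ℝ} (hv₀ : 0 < v₀)
    (D : Fin M → Obs d L) : (ridgeMatrix v₀ D).PosDef := by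
  refine Matrix.PosDef.add_posSemidef (Matrix.PosDef.one.smul (by positivity))
    (Matrix.PosSemidef.smul (Matrix.posSemidef_sum _ fun m _ => ?_) (by positivity))
  simpa using Matrix.posSemidef_conjTranspose_mul_self (ctrl (D m))

theorem ridgeMatrix_mulVec_ridgeRule (hd : 0 < d) (hM : 0 < M) {v₀ : ℝ} (hv₀ : 0 < v₀)
    (D : Fin M → Obs d L) : ridgeMatrix v₀ D *ᵥ ridgeRule v₀ D = -meanCh D := by
  rw [ridgeRule, Matrix.mulVec_neg, Matrix.mulVec_mulVec,
    Matrix.mul_nonsing_inv _ (posDef_ridgeMatrix hd hM hv₀ D).det_pos.ne'.isUnit,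
    Matrix.one_mulVec]

/-- Vanishing of the first variation of `postLoss` in the direction `b`; it is the defining linear
system of the rule, paired with `b` and multiplied by `M`. -/
theorem ridgeRule_normal_equation (hd : 0 < d) (hM : 0 < M) {v₀ : ℝ} (hv₀ : 0 < v₀)
    (D : Fin M → Obs d L) (b : Fin L → ℝ) :
    d * v₀ * (b ⬝ᵥ ridgeRule v₀ D) + ∑ m, (ctrl (D m) *ᵥ b) ⬝ᵥ
      (grad (D m) + ctrl (D m) *ᵥ ridgeRule v₀ D) = 0 := by
  have hM' : (M : ℝ) ≠ 0 := by positivity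
  have h := congrArg (fun z => (M : ℝ) * (b ⬝ᵥ z)) (ridgeMatrix_mulVec_ridgeRule hd hM hv₀ D)
  have hT (m : Fin M) (z : Fin d → ℝ) :
      b ⬝ᵥ (ctrl (D m))ᵀ *ᵥ z = (ctrl (D m) *ᵥ b) ⬝ᵥ z := by
    rw [Matrix.dotProduct_mulVec, Matrix.vecMul_transpose]
  simp only [ridgeMatrix, meanCC, meanCh, Matrix.add_mulVec, Matrix.smul_mulVec, Matrix.one_mulVec,
    Matrix.sum_mulVec, dotProduct_add, dotProduct_smul, dotProduct_sum, dotProduct_neg,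
    smul_eq_mul, ← Matrix.mulVec_mulVec, hT] at h
  simp only [dotProduct_add, Finset.sum_add_distrib]
  field_simp at h
  linarith

/-- Completing the square: the normal equation removes the cross term. The excess contains `d v₀ ‖a
- ridgeRule v₀ D‖²` with `d v₀ > 0`, hence uniqueness. -/
theorem postLoss_eq_add (hd : 0 < d) (hM : 0 < M) {v₀ : ℝ} (hv₀ : 0 < v₀)
    (D : Fin M → Obs d L) (a : Fin L → ℝ) :
    postLoss v₀ D a = postLoss v₀ D (ridgeRule v₀ D) +
      (d * v₀ * ((a - ridgeRule v₀ D) ⬝ᵥ (a - ridgeRule v₀ D)) +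
        ∑ m, (ctrl (D m) *ᵥ (a - ridgeRule v₀ D)) ⬝ᵥ (ctrl (D m) *ᵥ (a - ridgeRule v₀ D))) := by
  have h := ridgeRule_normal_equation hd hM hv₀ D (a - ridgeRule v₀ D)
  obtain ⟨b, rfl⟩ : ∃ b, a = ridgeRule v₀ D + b := ⟨a - ridgeRule v₀ D, by abel⟩
  rw [add_sub_cancel_left] at h ⊢
  have hm (m : Fin M) : (grad (D m) + ctrl (D m) *ᵥ (ridgeRule v₀ D + b)) ⬝ᵥ
        (grad (D m) + ctrl (D m) *ᵥ (ridgeRule v₀ D + b)) =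
      (grad (D m) + ctrl (D m) *ᵥ ridgeRule v₀ D) ⬝ᵥ (grad (D m) + ctrl (D m) *ᵥ ridgeRule v₀ D) +
        2 * ((ctrl (D m) *ᵥ b) ⬝ᵥ (grad (D m) + ctrl (D m) *ᵥ ridgeRule v₀ D)) +
        (ctrl (D m) *ᵥ b) ⬝ᵥ (ctrl (D m) *ᵥ b) := by
    rw [Matrix.mulVec_add, ← add_assoc, add_dotProduct, dotProduct_add, dotProduct_add _ _ (_ *ᵥ b),
      dotProduct_comm _ (ctrl (D m) *ᵥ b)]
    ring
  simp only [postLoss, hm, Finset.sum_add_distrib, ← Finset.mul_sum]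
  rw [add_dotProduct, dotProduct_add, dotProduct_add, dotProduct_comm _ b]
  linarith

theorem postLoss_nonneg {v₀ : ℝ} (hv₀ : 0 ≤ v₀) (D : Fin M → Obs d L) (a : Fin L → ℝ) :
    0 ≤ postLoss v₀ D a := by
  have h {k : ℕ} (z : Fin k → ℝ) : 0 ≤ z ⬝ᵥ z := Finset.sum_nonneg fun _ _ => mul_self_nonneg _
  have := h a
  exact add_nonneg (by positivity) (Finset.sum_nonneg fun m _ => h _)

theorem postLoss_ridgeRule_le (hd : 0 < d) (hM : 0 < M) {v₀ : ℝ} (hv₀ : 0 < v₀)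
    (D : Fin M → Obs d L) (a : Fin L → ℝ) : postLoss v₀ D (ridgeRule v₀ D) ≤ postLoss v₀ D a := by
  have h {k : ℕ} (z : Fin k → ℝ) : 0 ≤ z ⬝ᵥ z := Finset.sum_nonneg fun _ _ => mul_self_nonneg _
  rw [postLoss_eq_add hd hM hv₀ D a]
  have h1 := h (a - ridgeRule v₀ D)
  exact le_add_of_nonneg_right (add_nonneg (by positivity) (Finset.sum_nonneg fun m _ => h _))

theorem eq_ridgeRule_of_postLoss_eq (hd : 0 < d) (hM : 0 < M) {v₀ : ℝ} (hv₀ : 0 < v₀)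
    {D : Fin M → Obs d L} {a : Fin L → ℝ}
    (ha : postLoss v₀ D a = postLoss v₀ D (ridgeRule v₀ D)) : a = ridgeRule v₀ D := by
  have h {k : ℕ} (z : Fin k → ℝ) : 0 ≤ z ⬝ᵥ z := Finset.sum_nonneg fun _ _ => mul_self_nonneg _
  rw [postLoss_eq_add hd hM hv₀ D a] at ha
  have h1 := h (a - ridgeRule v₀ D)
  have h2 : 0 ≤ ∑ m, (ctrl (D m) *ᵥ (a - ridgeRule v₀ D)) ⬝ᵥ
      (ctrl (D m) *ᵥ (a - ridgeRule v₀ D)) := Finset.sum_nonneg fun m _ => h _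
  have h3 : 0 < d * v₀ := by positivity
  have h4 : (a - ridgeRule v₀ D) ⬝ᵥ (a - ridgeRule v₀ D) = 0 := by nlinarith
  exact sub_eq_zero.1 (dotProduct_self_eq_zero.1 h4)

theorem measurable_postLoss (v₀ : ℝ) {δ : Rule d L M} (hδ : Measurable δ) :
    Measurable fun D => postLoss v₀ D (δ D) := by
  have h1 (m : Fin M) (i : Fin d) (l : Fin L) := (continuous_ctrl_apply m i l).measurable
  have h2 (m : Fin M) (i : Fin d) := (continuous_grad_apply (L := L) m i).measurable
  have h3 (l : Fin L) : Measurable fun D => δ D l := measurable_pi_iff.1 hδ l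
  have h4 (m : Fin M) (i : Fin d) :
      Measurable fun D => (grad (D m) + ctrl (D m) *ᵥ δ D) i := by
    simp only [Pi.add_apply, Matrix.mulVec, dotProduct]
    exact (h2 m i).add (Finset.measurable_sum _ fun l _ => (h1 m i l).mul (h3 l))
  exact (((Finset.measurable_sum _ fun l _ => (h3 l).mul (h3 l)).add_const 1).const_mul _).add
    (Finset.measurable_sum _ fun m _ => Finset.measurable_sum _ fun i _ => (h4 m i).mul (h4 m i))

/-- A competitor of finite regret, which makes the minimum finite. Its action ignores the data, so
the data integrate out and the second-moment identity for the prior itself suffices. -/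
theorem bayesRegret_zero_lt_top {t₀ : Idx d L → ℝ} {n₀ v₀ : ℝ} (hn₀ : 0 < n₀) (hv₀ : 0 ≤ v₀)
    (hZ : ∫⁻ θ, priorDensity t₀ (v₀ • 1) n₀ θ ≠ ∞) :
    bayesRegret (prior t₀ (v₀ • 1) n₀) (fun _ => 0 : Rule d L M) < ∞ := by
  rw [bayesRegret, lintegral_prior]
  simp only [lintegral_const, measure_univ, mul_one]
  refine ENNReal.mul_lt_top
    (ENNReal.inv_lt_top.2 (pos_iff_ne_zero.2 (lintegral_priorDensity_ne_zero _ _ _))) ?_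
  have h1 : ∀ θ : Param (Idx d L), priorDensity t₀ (v₀ • 1) n₀ θ * loss 0 θ =
      priorDensity t₀ (v₀ • 1) n₀ θ *
        ∑ i : Fin d, ENNReal.ofReal (secondMoment (residualVec 0 i) θ) := by
    intro θ
    by_cases h : θ ∈ {θ : Param (Idx d L) | (precision θ).PosDef}
    · rw [loss_eq_sum_secondMoment _ h]
    · rw [priorDensity, indicator_of_notMem h, zero_mul, zero_mul]
  rw [lintegral_congr h1, lintegral_priorDensity_mul_loss _ hn₀ _ (fun i => ?_) hZ]
  · exact ENNReal.mul_lt_top ENNReal.ofReal_lt_top hZ.lt_top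
  · rw [Matrix.smul_mulVec, Matrix.one_mulVec, dotProduct_smul, residualVec_dotProduct_self]
    simp [hv₀]

end

end CVBayes

end

theorem mainTheorem1 (d L M : ℕ) (hd : 0 < d) (hM : 0 < M)
    (n₀ v₀ : ℝ) (hn₀ : 0 < n₀) (t₀ : CVBayes.Idx d L → ℝ) (ht₀ : t₀ ⬝ᵥ t₀ < n₀ * v₀) :
    IsProbabilityMeasure
        (CVBayes.prior t₀ (v₀ • (1 : Matrix (CVBayes.Idx d L) (CVBayes.Idx d L) ℝ)) n₀) ∧
    (∀ D : Fin M → CVBayes.Obs d L, IsUnit (CVBayes.ridgeMatrix v₀ D)) ∧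
    Measurable (CVBayes.ridgeRule v₀ : CVBayes.Rule d L M) ∧
    CVBayes.bayesRegret (CVBayes.prior t₀ (v₀ • 1) n₀)
        (CVBayes.ridgeRule v₀ : CVBayes.Rule d L M) < ∞ ∧
    ∀ δ : CVBayes.Rule d L M, Measurable δ →
      CVBayes.bayesRegret (CVBayes.prior t₀ (v₀ • 1) n₀)
          (CVBayes.ridgeRule v₀ : CVBayes.Rule d L M) ≤
        CVBayes.bayesRegret (CVBayes.prior t₀ (v₀ • 1) n₀) δ ∧
      (CVBayes.bayesRegret (CVBayes.prior t₀ (v₀ • 1) n₀) δ =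
          CVBayes.bayesRegret (CVBayes.prior t₀ (v₀ • 1) n₀)
            (CVBayes.ridgeRule v₀ : CVBayes.Rule d L M) ↔
        δ =ᵐ[volume] CVBayes.ridgeRule v₀) := by
  open CVBayes Filter in
  have hv₀ : 0 < v₀ := by
    have h0 : 0 ≤ t₀ ⬝ᵥ t₀ := Finset.sum_nonneg fun _ _ => mul_self_nonneg _
    exact (mul_pos_iff_of_pos_left hn₀).1 (h0.trans_lt ht₀)
  have hZ := lintegral_priorDensity_ne_top t₀ hn₀ ht₀
  have hZ0 := lintegral_priorDensity_ne_zero t₀ (v₀ • (1 : Matrix (Idx d L) (Idx d L) ℝ)) n₀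
  have hZinv0 : (∫⁻ θ, priorDensity t₀ (v₀ • 1) n₀ θ)⁻¹ ≠ 0 := ENNReal.inv_ne_zero.2 hZ
  have hZinv : (∫⁻ θ, priorDensity t₀ (v₀ • 1) n₀ θ)⁻¹ ≠ ∞ := ENNReal.inv_ne_top.2 hZ0
  have hr : Measurable (ridgeRule v₀ : Rule d L M) := measurable_ridgeRule v₀
  have hle : ∀ (δ : Rule d L M) (D : Fin M → Obs d L),
      ENNReal.ofReal (postLoss v₀ D (ridgeRule v₀ D) / (n₀ + M)) *
        ∫⁻ θ, postDensity t₀ (v₀ • 1) n₀ D θ ≤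
      ENNReal.ofReal (postLoss v₀ D (δ D) / (n₀ + M)) *
        ∫⁻ θ, postDensity t₀ (v₀ • 1) n₀ D θ := fun δ D => by
    gcongr
    exact postLoss_ridgeRule_le hd hM hv₀ D _
  have hmin : ∀ δ : Rule d L M, Measurable δ →
      bayesRegret (prior t₀ (v₀ • 1) n₀) (ridgeRule v₀ : Rule d L M) ≤
        bayesRegret (prior t₀ (v₀ • 1) n₀) δ := fun δ hδ => by
    rw [bayesRegret_eq hn₀ hv₀.le hZ hr, bayesRegret_eq hn₀ hv₀.le hZ hδ]
    exact mul_le_mul_right (lintegral_mono (hle δ)) _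
  have hfin : bayesRegret (prior t₀ (v₀ • 1) n₀) (ridgeRule v₀ : Rule d L M) < ∞ :=
    (hmin _ measurable_const).trans_lt (bayesRegret_zero_lt_top hn₀ hv₀.le hZ)
  refine ⟨⟨?_⟩, fun D => (posDef_ridgeMatrix hd hM hv₀ D).isUnit, hr, hfin,
    fun δ hδ => ⟨hmin δ hδ, fun heq => ?_, fun hae => ?_⟩⟩
  · rw [prior, Measure.smul_apply, unnormalizedPrior_univ, smul_eq_mul, ENNReal.inv_mul_cancel hZ0 hZ]
  · rw [bayesRegret_eq hn₀ hv₀.le hZ hr] at heq hfin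
    rw [bayesRegret_eq hn₀ hv₀.le hZ hδ, ENNReal.mul_right_inj hZinv0 hZinv] at heq
    have hfin' := (ENNReal.lt_top_of_mul_ne_top_right hfin.ne hZinv0).ne
    have hm : Measurable fun D : Fin M → Obs d L => ENNReal.ofReal (postLoss v₀ D (δ D) / (n₀ + M)) *
        ∫⁻ θ, postDensity t₀ (v₀ • 1) n₀ D θ :=
      ((measurable_postLoss v₀ hδ).div_const _).ennreal_ofReal.mul
        (measurable_postDensity t₀ (v₀ • 1) n₀).lintegral_prod_right'
    -- Ordered integrands with equal finite integrals agree almost everywhere.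
    have hae := ae_eq_of_ae_le_of_lintegral_le (Eventually.of_forall (hle δ)) hfin' hm.aemeasurable
      heq.le
    filter_upwards [hae, ae_lintegral_postDensity_lt_top (M := M) hZ] with D hD hDfin
    -- The marginal density is positive at every data set, so it can be cancelled and the conclusion
    -- holds up to Lebesgue-null sets.
    have hD0 : ∫⁻ θ, postDensity t₀ (v₀ • 1) n₀ D θ ≠ 0 := lintegral_priorDensity_ne_zero _ _ _
    rw [ENNReal.mul_left_inj hD0 hDfin.ne,
      ENNReal.ofReal_eq_ofReal_iff (div_nonneg (postLoss_nonneg hv₀.le _ _) (by positivity))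
        (div_nonneg (postLoss_nonneg hv₀.le _ _) (by positivity)),
      div_left_inj' (by positivity)] at hD
    exact eq_ridgeRule_of_postLoss_eq hd hM hv₀ hD.symm
  · rw [bayesRegret_eq hn₀ hv₀.le hZ hr, bayesRegret_eq hn₀ hv₀.le hZ hδ]
    congr 1
    refine lintegral_congr_ae ?_
    filter_upwards [hae] with D hD
    rw [hD]
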